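/- Let $l\ge-\frac12$. For $z\in\mathbb C\setminus\{0\}$ and $x\in(0,1)$ put $$\phi_l(z,x)=z^{-\frac{2l+1}{4}}\sqrt{\tfrac{\pi x}{2}}\,J_{l+\frac12}(\sqrt z\,x),$$ $$\theta_l(z,x)=-z^{\frac{2l+1}{4}}\sqrt{\tfrac{\pi x}{2}}\begin{cases}\frac{-1}{\sin((l+\frac12)\pi)}J_{-l-\frac12}(\sqrt z\,x), & l+\frac12\notin\mathbb N_0,\\ Y_{l+\frac12}(\sqrt z\,x)-\frac1\pi\log(z)J_{l+\frac12}(\sqrt z\,x), & l+\frac12\in\mathbb N_0,\end{cases}$$ where $J$ and $Y$ are the Bessel and Neumann functions and all branches are principal. For fixed $x$ both functions extend to entire functions of $z$; their values at $z=0$ are those of this extension, namely $\phi_l(0,x)=\frac{\sqrt\pi}{\Gamma(l+\frac32)2^{l+1}}x^{l+1}$, $\theta_l(0,x)=\frac{\Gamma(l+\frac32)2^{l+1}}{\sqrt\pi\,(2l+1)}x^{-l}$ for $l>-\frac12$, and $\theta_{-1/2}(0,x)=\sqrt{\frac{2x}{\pi}}\,(\log 2-\gamma-\log x)$ with $\gamma$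 the Euler--Mascheroni constant. Let $$G_l(z,x,y)=\phi_l(z,x)\theta_l(z,y)-\phi_l(z,y)\theta_l(z,x).$$ (i) For every $l>-\frac12$ there is a constant $C$, depending only on $l$, such that for all $z\in\mathbb C$ and $x\in(0,1)$ $$|\phi_l(z,x)|\le C\Big(\frac{x}{1+|z|^{1/2}x}\Big)^{l+1}e^{|\mathrm{Im}\sqrt z|\,x},$$ and for all $z\in\mathbb C$ and $0<y\le x<1$ $$|G_l(z,x,y)|\le C\Big(\frac{x}{1+|z|^{1/2}x}\Big)^{l+1}\Big(\frac{1+|z|^{1/2}y}{y}\Big)^{l}e^{|\mathrm{Im}\sqrt z|(x-y)}.$$ (ii) For $l=-\frac12$ there is a constant $C$ such that the first bound of (i) holds with $l=-\frac12$ for all $z\in\mathbb C$, $x\in(0,1)$, and for all $z\in\mathbb C$ and $0<y\le x<1$ $$|G_{-1/2}(z,x,y)|\le C\Big(\frac{xy}{(1+|z|^{1/2}x)(1+|z|^{1/2}y)}\Big)^{1/2}e^{|\mathrm{Im}\sqrt z|(x-y)}\,(1-\log y).$$ -/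

import Mathlib

noncomputable section

namespace SphericalSchrodinger

/-- The Bessel function of the first kind of real order `ν`,
`J_ν(w) = (w/2)^ν ∑ₖ (-1)^k (w²/4)^k / (k! Γ(ν+k+1))`, with the principal branch of the power.
At the poles of `Γ` Mathlib has `Γ = 0`, so the corresponding terms vanish, as they should. -/
def besselJ (ν : ℝ) (w : ℂ) : ℂ :=
  (w / 2) ^ (ν : ℂ) *
    ∑' k : ℕ, (-1) ^ k * (w ^ 2 / 4) ^ k / ((k.factorial : ℂ) * Complex.Gamma (ν + k + 1))

/-- The Neumann function (Bessel function of the second kind) of order `n ∈ ℕ₀`,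
`Y_n(w) = -(1/π)(w/2)^{-n} ∑_{k<n} (n-k-1)!/k! (w²/4)^k + (2/π) log(w/2) J_n(w)
  - (1/π)(w/2)^n ∑ₖ (ψ(k+1) + ψ(n+k+1)) (-w²/4)^k / (k! (n+k)!)`,
with the principal branch of the logarithm and the digamma values `ψ(m+1) = H_m - γ`,
where `H_m` is the `m`-th harmonic number and `γ` the Euler–Mascheroni constant. -/
def neumannY (n : ℕ) (w : ℂ) : ℂ :=
  -(1 / (Real.pi : ℂ)) * ((w / 2) ^ n)⁻¹ *
      ∑ k ∈ Finset.range n, ((n - k - 1).factorial : ℂ) / (k.factorial : ℂ) * (w ^ 2 / 4) ^ k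
    + 2 / (Real.pi : ℂ) * Complex.log (w / 2) * besselJ n w
    - 1 / (Real.pi : ℂ) * (w / 2) ^ n *
      ∑' k : ℕ, ((harmonic k : ℂ) + (harmonic (n + k) : ℂ)
          - 2 * (Real.eulerMascheroniConstant : ℂ)) *
        ((-1) ^ k * (w ^ 2 / 4) ^ k / ((k.factorial : ℂ) * ((n + k).factorial : ℂ)))

/-- The principal square root `√z`. -/
def csqrt (z : ℂ) : ℂ := z ^ (1 / 2 : ℂ)

/-- The solution `φ_l(z,x) = z^{-(2l+1)/4} √(πx/2) J_{l+1/2}(√z x)` of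
`-f'' + l(l+1)/x² f = z f`. It is entire in `z`; its value at `z = 0` is
`√π x^{l+1} / (Γ(l+3/2) 2^{l+1})`. -/
def phi (l : ℝ) (z : ℂ) (x : ℝ) : ℂ :=
  if z = 0 then
    ((Real.sqrt Real.pi / (Real.Gamma (l + 3 / 2) * 2 ^ (l + 1)) * x ^ (l + 1) : ℝ) : ℂ)
  else
    z ^ (-(2 * (l : ℂ) + 1) / 4) * (Real.sqrt (Real.pi * x / 2) : ℂ)
      * besselJ (l + 1 / 2) (csqrt z * x)

open Classical in
/-- The second solution `θ_l(z,x)`, for `l ≥ -1/2`: it is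
`-z^{(2l+1)/4} √(πx/2)` times `-J_{-l-1/2}(√z x) / sin((l+1/2)π)` if `l + 1/2 ∉ ℕ₀`, and times
`Y_{l+1/2}(√z x) - (1/π) log(z) J_{l+1/2}(√z x)` if `l + 1/2 ∈ ℕ₀`. It is entire in `z`;
its value at `z = 0` is `√(2x/π) (log 2 - γ - log x)` if `l = -1/2` and
`Γ(l+3/2) 2^{l+1} / (√π (2l+1)) x^{-l}` otherwise. -/
def theta (l : ℝ) (z : ℂ) (x : ℝ) : ℂ :=
  if z = 0 then
    if l = -1 / 2 then
      ((Real.sqrt (2 * x / Real.pi)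
        * (Real.log 2 - Real.eulerMascheroniConstant - Real.log x) : ℝ) : ℂ)
    else
      ((Real.Gamma (l + 3 / 2) * 2 ^ (l + 1) / (Real.sqrt Real.pi * (2 * l + 1))
        * x ^ (-l) : ℝ) : ℂ)
  else
    -z ^ ((2 * (l : ℂ) + 1) / 4) * (Real.sqrt (Real.pi * x / 2) : ℂ) *
      (if ∃ n : ℕ, l + 1 / 2 = n then
        neumannY ⌊l + 1 / 2⌋₊ (csqrt z * x)
          - 1 / (Real.pi : ℂ) * Complex.log z * besselJ (l + 1 / 2) (csqrt z * x)
      else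
        -1 / (Real.sin ((l + 1 / 2) * Real.pi) : ℂ) * besselJ (-l - 1 / 2) (csqrt z * x))

/-- The Green function of the initial value problem,
`G_l(z,x,y) = φ_l(z,x) θ_l(z,y) - φ_l(z,y) θ_l(z,x)`. -/
def green (l : ℝ) (z : ℂ) (x y : ℝ) : ℂ :=
  phi l z x * theta l z y - phi l z y * theta l z x

end SphericalSchrodinger

end

namespace SphericalSchrodinger

/-! Put `ν = l + 1/2`. Dividing `φ_l` and `θ_l` by `√x` gives, up to constants, solutions `p`, `q`
of Bessel's equation `(x d/dx)² g = (ν² - z x²) g`; their explicit series serve only to check the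
equation, to compute the Wronskian and to bound `p` near `0`.

The Green function is `const · √x √y · K(x)` with `K(x) = q(y) p(x) - p(y) q(x)`. As a function of
`x`, `K` solves the same equation, vanishes at `y`, and `x K'` at `x = y` is minus the Wronskian of
`p` and `q`. That Wronskian is a continuous function of `z x²/4` and is constant in `x`, so it
equals its value at `0` and does not depend on `z` (`BesselSol.wronskian_eq`, `exists_theta`). No
bound on `θ_l` itself is needed: it suffices to estimate solutions with Cauchy data `0`, `g₁ y` at
`y`.

With `s = √z` there are two regimes. For `‖s‖ x ≤ 1` the term `z x²` is a perturbation of `(x d/dx)²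
g = ν² g`, absorbed by a maximum argument (`BesselSol.norm_le_of_le_one`). For `‖s‖ x ≥ 1` the
energy `|f'|² + ‖s‖² |f|²` of `f = √x g` grows at most like `exp (2 |Im s| x)` (`energy_le`,
`BesselSol.norm_le_of_one_le`). If `y` lies in the first region and `x` in the second, the estimates
are joined at `1/‖s‖`. The weight `x / (1 + ‖s‖ x)` is comparable to `min x (1/‖s‖)`, which puts all
cases in one formula. The logarithm at `ν = 0` comes from the integral of `1/t` from `y` to `x`. -/

/-! ### Everywhere convergent power series. -/

/-- The sum of the power series with coefficients `a`. -/
noncomputable def psum (a : ℕ → ℂ) (t : ℂ) : ℂ := ∑' k, a k * t ^ k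

/-- The power series with coefficients `a` converges absolutely everywhere. -/
def EntireCoeff (a : ℕ → ℂ) : Prop := ∀ r : ℝ, Summable fun k => ‖a k‖ * r ^ k

theorem EntireCoeff.summable {a : ℕ → ℂ} (ha : EntireCoeff a) (t : ℂ) :
    Summable fun k => a k * t ^ k := by
  refine Summable.of_norm ?_
  simpa [norm_mul, norm_pow] using ha ‖t‖

theorem EntireCoeff.of_norm_le {a b : ℕ → ℂ} (ha : EntireCoeff a) (h : ∀ k, ‖b k‖ ≤ ‖a k‖) :
    EntireCoeff b := by
  intro r
  refine Summable.of_norm_bounded (g := fun k => ‖a k‖ * |r| ^ k) (ha _) fun k => ?_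
  rw [norm_mul, norm_norm, norm_pow, Real.norm_eq_abs]
  gcongr
  exact h k

theorem EntireCoeff.add {a b : ℕ → ℂ} (ha : EntireCoeff a) (hb : EntireCoeff b) :
    EntireCoeff fun k => a k + b k := by
  intro r
  refine Summable.of_norm_bounded (g := fun k => ‖a k‖ * |r| ^ k + ‖b k‖ * |r| ^ k)
    ((ha _).add (hb _)) fun k => ?_
  rw [norm_mul, norm_norm, norm_pow, Real.norm_eq_abs, ← add_mul]
  gcongr
  exact norm_add_le _ _

theorem EntireCoeff.const_mul {a : ℕ → ℂ} (ha : EntireCoeff a) (c : ℂ) :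
    EntireCoeff fun k => c * a k := by
  intro r
  simpa [norm_mul, mul_assoc] using (ha r).mul_left ‖c‖

theorem EntireCoeff.natCast_mul {a : ℕ → ℂ} (ha : EntireCoeff a) :
    EntireCoeff fun k => (k : ℂ) * a k := by
  intro r
  refine Summable.of_norm_bounded (g := fun k => ‖a k‖ * (2 * |r|) ^ k) (ha _) fun k => ?_
  rw [norm_mul, norm_norm, norm_mul, norm_pow, Real.norm_eq_abs, mul_pow, Complex.norm_natCast]
  -- Doubling the radius pays for the factor `k`.
  have : (k : ℝ) ≤ 2 ^ k := by exact_mod_cast Nat.lt_two_pow_self.le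
  calc (k : ℝ) * ‖a k‖ * |r| ^ k ≤ 2 ^ k * ‖a k‖ * |r| ^ k := by gcongr
    _ = _ := by ring

theorem EntireCoeff.affine_mul {a : ℕ → ℂ} (ha : EntireCoeff a) (μ c : ℂ) :
    EntireCoeff fun k => (μ + c * k) * a k := by
  convert (ha.const_mul μ).add (ha.natCast_mul.const_mul c) using 2
  ring

theorem entireCoeff_of_finite_support {a : ℕ → ℂ} (n : ℕ) (h : ∀ k, n ≤ k → a k = 0) :
    EntireCoeff a := fun r =>
  summable_of_ne_finset_zero (s := Finset.range n) fun k hk => by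
    rw [h k (by simpa using hk), norm_zero, zero_mul]

/-- Ratio test: once `k ≥ |ν| + 2 |r|`, the factor `(k + 1)(k + 1 + ν)` is at least `2 |r|`. Only
large `k` matter, so `ν` may be negative. -/
theorem entireCoeff_of_recurrence {a : ℕ → ℂ} {ν : ℝ}
    (h : ∀ k : ℕ, ((k : ℂ) + 1) * (k + 1 + ν) * a (k + 1) = -a k) : EntireCoeff a := by
  intro r
  refine summable_of_ratio_norm_eventually_le (r := 1 / 2) (by norm_num) ?_
  obtain ⟨N, hN⟩ := exists_nat_ge (|ν| + 2 * |r|)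
  filter_upwards [Filter.eventually_ge_atTop N] with k hk
  have hk' : (N : ℝ) ≤ k := by exact_mod_cast hk
  have h1 : (2 * |r|) * ‖a (k + 1)‖ ≤ ‖a k‖ := by
    rw [← norm_neg (a k), ← h k, norm_mul]
    gcongr
    have e : ((k : ℂ) + 1) * (k + 1 + ν) = (((k + 1) * (k + 1 + ν) : ℝ) : ℂ) := by push_cast; ring
    rw [e, Complex.norm_real, Real.norm_eq_abs]
    have h2 := neg_abs_le ν
    have h3 := abs_nonneg r
    have h4 : (0 : ℝ) ≤ k := k.cast_nonneg
    refine le_trans ?_ (le_abs_self _)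
    nlinarith
  simp only [norm_mul, norm_pow, Real.norm_eq_abs, abs_norm, pow_succ]
  have := mul_le_mul_of_nonneg_right h1 (pow_nonneg (abs_nonneg r) k)
  linarith

theorem psum_add {a b : ℕ → ℂ} (ha : EntireCoeff a) (hb : EntireCoeff b) (t : ℂ) :
    psum (fun k => a k + b k) t = psum a t + psum b t := by
  simp only [psum, add_mul]
  exact (ha.summable t).tsum_add (hb.summable t)

theorem psum_const_mul (a : ℕ → ℂ) (c t : ℂ) :
    psum (fun k => c * a k) t = c * psum a t := by
  simp only [psum, mul_assoc]
  exact tsum_mul_left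

/-- The index shift that turns a two-term recurrence of coefficients into a differential equation
for the sum. -/
theorem mul_psum {a c : ℕ → ℂ} (ha : EntireCoeff a) (h0 : c 0 = 0) (hc : ∀ k, c (k + 1) = a k)
    (t : ℂ) : t * psum a t = psum c t := by
  have hs : Summable fun k => c (k + 1) * t ^ (k + 1) := by
    simpa only [hc, pow_succ, mul_assoc] using (ha.summable t).mul_right t
  have hs' : Summable fun k => c k * t ^ k := (summable_nat_add_iff 1).1 hs
  rw [psum, psum, hs'.tsum_eq_zero_add, h0, zero_mul, zero_add, ← tsum_mul_left]
  exact tsum_congr fun k => by rw [hc]; ring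

theorem psum_eq_single {a : ℕ → ℂ} (n : ℕ) (h : ∀ k, k ≠ n → a k = 0) (t : ℂ) :
    psum a t = a n * t ^ n :=
  tsum_eq_single n fun k hk => by rw [h k hk, zero_mul]

theorem norm_psum_le {a : ℕ → ℂ} (ha : EntireCoeff a) {t : ℂ} (ht : ‖t‖ ≤ 1) :
    ‖psum a t‖ ≤ ∑' k, ‖a k‖ := by
  have h1 : Summable fun k => ‖a k‖ := by simpa using ha 1
  refine tsum_of_norm_bounded h1.hasSum fun k => ?_
  rw [norm_mul, norm_pow]
  exact mul_le_of_le_one_right (norm_nonneg _) (pow_le_one₀ (norm_nonneg _) ht)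

/-- The derivative is recorded only through `t d/dt`, which acts diagonally on coefficients; this is
all that `x d/dx` of a Frobenius series requires. -/
theorem exists_hasDerivAt_psum {a : ℕ → ℂ} (ha : EntireCoeff a) (t : ℂ) :
    ∃ d, HasDerivAt (psum a) d t ∧ t * d = psum (fun k => (k : ℂ) * a k) t := by
  set R : ℝ := ‖t‖ + 1
  have hR : 1 ≤ R := by simp [R]
  have hu : Summable fun k : ℕ => ‖a k‖ * (2 * R) ^ k := ha _
  refine ⟨∑' k, a k * ((k : ℂ) * t ^ (k - 1)), ?_, ?_⟩
  · refine hasDerivAt_tsum_of_isPreconnected (t := Metric.ball (0 : ℂ) R) (y₀ := 0)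
      (g := fun k t => a k * t ^ k) (g' := fun k t => a k * ((k : ℂ) * t ^ (k - 1))) hu
      Metric.isOpen_ball (convex_ball _ _).isPreconnected ?_ ?_ ?_ (ha.summable 0) ?_
    · intro k y _
      exact (hasDerivAt_pow k y).const_mul (a k)
    · intro k y hy
      rw [norm_mul, norm_mul, norm_pow, Complex.norm_natCast]
      have hy' : ‖y‖ ≤ R := by simpa using (Metric.mem_ball.1 hy).le
      gcongr
      rw [mul_pow]
      gcongr
      · exact_mod_cast Nat.lt_two_pow_self.le
      · exact (pow_le_pow_left₀ (norm_nonneg _) hy' _).trans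
          (pow_le_pow_right₀ hR (Nat.sub_le _ _))
    · simp; positivity
    · simp [R]
  · rw [psum, ← tsum_mul_left]
    refine tsum_congr fun k => ?_
    rcases k with _ | k
    · simp
    · simp only [Nat.add_sub_cancel]; ring

theorem continuous_psum {a : ℕ → ℂ} (ha : EntireCoeff a) : Continuous (psum a) :=
  continuous_iff_continuousAt.2 fun t => (exists_hasDerivAt_psum ha t).choose_spec.1.continuousAt

/-! ### Frobenius series, Bessel's equation and the Wronskian. -/

/-- The Frobenius series `(x/2)^μ ∑ₖ bₖ (z x²/4)^k`. -/
noncomputable def frob (μ : ℝ) (b : ℕ → ℂ) (z : ℂ) (x : ℝ) : ℂ :=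
  (((x / 2) ^ μ : ℝ) : ℂ) * psum b (z * x ^ 2 / 4)

/-- The `k`-th term is a multiple of `x ^ (μ + 2k)`, an eigenfunction of `x d/dx` with eigenvalue `μ
+ 2k`. -/
theorem hasDerivAt_frob {b : ℕ → ℂ} (hb : EntireCoeff b) (μ : ℝ) (z : ℂ) {x : ℝ} (hx : 0 < x) :
    HasDerivAt (frob μ b z) (frob μ (fun k => (μ + 2 * k) * b k) z x / x) x := by
  obtain ⟨d, hd, htd⟩ := exists_hasDerivAt_psum hb (z * x ^ 2 / 4)
  have h1 : HasDerivAt (fun x : ℝ => z * (x : ℂ) ^ 2 / 4) (z * (2 * x) / 4) x := by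
    have := (((hasDerivAt_id (x : ℂ)).pow 2).const_mul z).div_const 4
    simpa using this.comp_ofReal
  have h2 : HasDerivAt (fun x : ℝ => psum b (z * x ^ 2 / 4)) (d * (z * (2 * x) / 4)) x :=
    HasDerivAt.comp (h₂ := psum b) x hd h1
  have h3 : HasDerivAt (fun x : ℝ => (x / 2) ^ μ) (μ * (x / 2) ^ μ / x) x := by
    have := ((hasDerivAt_id' x).div_const 2).rpow_const (p := μ) (Or.inl (by positivity))
    refine this.congr_deriv ?_
    rw [Real.rpow_sub_one (by positivity)]
    field_simp
  refine (h3.ofReal_comp.mul h2).congr_deriv ?_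
  have hx' : (x : ℂ) ≠ 0 := by exact_mod_cast hx.ne'
  have e : psum (fun k => (μ + 2 * k) * b k) (z * x ^ 2 / 4)
      = μ * psum b (z * x ^ 2 / 4) + 2 * (z * x ^ 2 / 4 * d) := by
    rw [htd, ← psum_const_mul, ← psum_const_mul,
      ← psum_add (hb.const_mul _) (hb.natCast_mul.const_mul _)]
    congr 1; ext k; ring
  rw [frob, e]
  push_cast
  field_simp

theorem frob_mul_frob_neg (ν : ℝ) (a b : ℕ → ℂ) (z : ℂ) {x : ℝ} (hx : 0 < x) :
    frob ν a z x * frob (-ν) b z x = psum a (z * x ^ 2 / 4) * psum b (z * x ^ 2 / 4) := by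
  have h : (((x / 2) ^ ν : ℝ) : ℂ) * (((x / 2) ^ (-ν) : ℝ) : ℂ) = 1 := by
    rw [← Complex.ofReal_mul, ← Real.rpow_add (by positivity)]; simp
  rw [frob, frob]
  linear_combination (psum a (z * x ^ 2 / 4) * psum b (z * x ^ 2 / 4)) * h

/-- `g` solves Bessel's equation `(x d/dx)² g = (ν² - z x²) g` on `(0, ∞)`, and `g₁ = x g'`. -/
def BesselSol (ν : ℝ) (z : ℂ) (g g₁ : ℝ → ℂ) : Prop :=
  ∀ x : ℝ, 0 < x → HasDerivAt g (g₁ x / x) x ∧ HasDerivAt g₁ ((ν ^ 2 - z * x ^ 2) * g x / x) x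

theorem BesselSol.const_mul {ν : ℝ} {z : ℂ} {g g₁ : ℝ → ℂ} (h : BesselSol ν z g g₁) (c : ℂ) :
    BesselSol ν z (fun x => c * g x) (fun x => c * g₁ x) := fun x hx => by
  refine ⟨?_, ?_⟩
  · exact ((h x hx).1.const_mul c).congr_deriv (by ring)
  · exact ((h x hx).2.const_mul c).congr_deriv (by ring)

theorem BesselSol.sub {ν : ℝ} {z : ℂ} {g g₁ k k₁ : ℝ → ℂ} (h : BesselSol ν z g g₁)
    (h' : BesselSol ν z k k₁) :
    BesselSol ν z (fun x => g x - k x) (fun x => g₁ x - k₁ x) := fun x hx => by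
  refine ⟨?_, ?_⟩
  · exact ((h x hx).1.sub (h' x hx).1).congr_deriv (by ring)
  · exact ((h x hx).2.sub (h' x hx).2).congr_deriv (by ring)

/-- The Wronskian is a constant, equal to its limit at `0`. -/
theorem BesselSol.wronskian_eq {ν : ℝ} {z : ℂ} {g g₁ k k₁ : ℝ → ℂ} (h : BesselSol ν z g g₁)
    (h' : BesselSol ν z k k₁) {w : ℂ → ℂ} (hw : Continuous w)
    (e : ∀ x : ℝ, 0 < x → g x * k₁ x - g₁ x * k x = w (z * x ^ 2 / 4)) {x : ℝ} (hx : 0 < x) :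
    g x * k₁ x - g₁ x * k x = w 0 := by
  set W : ℝ → ℂ := fun x => g x * k₁ x - g₁ x * k x
  have hd : ∀ y ∈ Set.Ioi (0 : ℝ), HasDerivAt W 0 y := by
    intro y hy
    have hy' : (y : ℂ) ≠ 0 := by exact_mod_cast (ne_of_gt hy)
    refine (((h y hy).1.mul (h' y hy).2).sub ((h y hy).2.mul (h' y hy).1)).congr_deriv ?_
    field_simp
    ring
  have hc : ∀ y, 0 < y → W y = W x := fun y hy =>
    IsOpen.is_const_of_deriv_eq_zero isOpen_Ioi (convex_Ioi 0).isPreconnected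
      (fun y hy => (hd y hy).differentiableAt.differentiableWithinAt)
      (fun y hy => (hd y hy).deriv) hy hx
  -- Letting `x → 0` sends the argument `z x²/4` to `0` whatever `z` is, hence a limit independent
  -- of `z`.
  have hlim : Filter.Tendsto (fun y : ℝ => w (z * y ^ 2 / 4)) (nhdsWithin 0 (Set.Ioi 0))
      (nhds (w 0)) := by
    have : Continuous fun y : ℝ => w (z * y ^ 2 / 4) := by fun_prop
    simpa using (this.tendsto 0).mono_left nhdsWithin_le_nhds
  refine tendsto_nhds_unique (tendsto_const_nhds.congr' ?_) hlim
  filter_upwards [self_mem_nhdsWithin] with y hy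
  rw [← e y hy]
  exact (hc y hy).symm

/-- Since `(ν + 2k)² = ν² + 4k(k + ν)`, the recurrence says that `(x d/dx)² - ν²` acts as
multiplication by `-z x²`. The order `μ` enters only through its square, so the series with exponent
`-ν` is covered too. -/
theorem besselSol_frob {a : ℕ → ℂ} {ν : ℝ}
    (h : ∀ k : ℕ, ((k : ℂ) + 1) * (k + 1 + ν) * a (k + 1) = -a k) (z : ℂ) {μ : ℝ}
    (hμ : μ ^ 2 = ν ^ 2) :
    BesselSol μ z (frob ν a z) (frob ν (fun k => (ν + 2 * k) * a k) z) := by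
  have ha := entireCoeff_of_recurrence h
  intro x hx
  refine ⟨hasDerivAt_frob ha ν z hx, ?_⟩
  convert hasDerivAt_frob (ha.affine_mul ν 2) ν z hx using 2
  have hμ' : (μ : ℂ) ^ 2 = ν ^ 2 := by exact_mod_cast hμ
  have e : (-4 : ℂ) * (z * x ^ 2 / 4 * psum a (z * x ^ 2 / 4)) =
      psum (fun k : ℕ => 4 * k * (k + ν) * a k) (z * x ^ 2 / 4) := by
    rw [mul_left_comm, ← psum_const_mul]
    refine mul_psum (ha.const_mul _) (by simp) (fun k => ?_) _
    push_cast
    linear_combination 4 * h k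
  have e2 : psum (fun k : ℕ => (ν + 2 * k) * ((ν + 2 * k) * a k)) (z * x ^ 2 / 4) =
      psum (fun k : ℕ => ν ^ 2 * a k + 4 * k * (k + ν) * a k) (z * x ^ 2 / 4) := by
    congr 1; ext k; ring
  have he : EntireCoeff fun k : ℕ => 4 * k * (k + ν) * a k := by
    convert ((ha.affine_mul ν 1).natCast_mul.const_mul 4) using 2; ring
  rw [frob, frob, e2, psum_add (ha.const_mul _) he, psum_const_mul, ← e, hμ']
  ring

/-! ### Growth of solutions for large and for small `‖s‖ x`. -/

/-- Because `‖s‖² - s² = (conj s - s) s`. This is why only `|Im s|` appears in the exponential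
growth rate. -/
theorem norm_sq_sub_sq (s : ℂ) : ‖((‖s‖ ^ 2 : ℝ) : ℂ) - s ^ 2‖ = 2 * |s.im| * ‖s‖ := by
  have e : ((‖s‖ ^ 2 : ℝ) : ℂ) - s ^ 2 = ((starRingEnd ℂ) s - s) * s := by
    rw [Complex.ofReal_pow, ← Complex.conj_mul']; ring
  have e2 : (starRingEnd ℂ) s - s = ((-2 * s.im : ℝ) : ℂ) * Complex.I := by
    apply Complex.ext <;> simp; ring
  rw [e, norm_mul, e2, norm_mul, Complex.norm_I, mul_one, Complex.norm_real, Real.norm_eq_abs,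
    abs_mul]
  norm_num

/-- Energy estimate for `f'' = (c / x² - s²) f`. -/
theorem energy_le {f f' : ℝ → ℂ} {c : ℝ} {s : ℂ} (hs : s ≠ 0) {a b : ℝ} (ha : 0 < a) (hab : a ≤ b)
    (h1 : ∀ x, 0 < x → HasDerivAt f (f' x) x)
    (h2 : ∀ x : ℝ, 0 < x → HasDerivAt f' ((c / x ^ 2 - s ^ 2) * f x) x) :
    ‖f' b‖ ^ 2 + ‖s‖ ^ 2 * ‖f b‖ ^ 2 ≤ (‖f' a‖ ^ 2 + ‖s‖ ^ 2 * ‖f a‖ ^ 2) *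
      Real.exp (2 * |s.im| * (b - a) + |c| / (‖s‖ * a)) := by
  have hs' : 0 < ‖s‖ := norm_pos_iff.2 hs
  set W : ℝ → ℝ := fun x => ‖f' x‖ ^ 2 + ‖s‖ ^ 2 * ‖f x‖ ^ 2
  -- The logarithm of the integrating factor: `W exp p` is shown to be nonincreasing, `-p'` being
  -- the growth rate in `hbound`.
  set p : ℝ → ℝ := fun x => -(2 * |s.im| * x) + |c| / ‖s‖ * x⁻¹
  set W' : ℝ → ℝ := fun x => 2 * inner ℝ (f' x) ((c / x ^ 2 - s ^ 2) * f x)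
    + ‖s‖ ^ 2 * (2 * inner ℝ (f x) (f' x))
  have hW : ∀ x, 0 < x → HasDerivAt W (W' x) x := fun x hx =>
    (h2 x hx).norm_sq.add ((h1 x hx).norm_sq.const_mul _)
  have hp : ∀ x, 0 < x → HasDerivAt p (-(2 * |s.im|) + |c| / ‖s‖ * (-(x ^ 2)⁻¹)) x := by
    intro x hx
    exact (((hasDerivAt_id' x).const_mul (2 * |s.im|)).neg.add
      ((hasDerivAt_inv hx.ne').const_mul (|c| / ‖s‖))).congr_deriv (by ring)
  have hbound : ∀ x, 0 < x → W' x ≤ (2 * |s.im| + |c| / ‖s‖ * (x ^ 2)⁻¹) * W x := by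
    intro x hx
    -- The term `‖s‖² ⟨f, f'⟩` is merged into the other inner product, so that `-s²` is replaced by
    -- the small quantity `‖s‖² - s²`.
    have e : W' x = 2 * inner ℝ (f' x) ((c / x ^ 2 - s ^ 2 + ((‖s‖ ^ 2 : ℝ) : ℂ)) * f x) := by
      have : (c / x ^ 2 - s ^ 2 + ((‖s‖ ^ 2 : ℝ) : ℂ)) * f x
          = (c / x ^ 2 - s ^ 2) * f x + (‖s‖ ^ 2 : ℝ) • f x := by
        rw [Complex.real_smul]; ring
      rw [this, inner_add_right, real_inner_smul_right, real_inner_comm (f x) (f' x)]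
      simp only [W']; ring
    have h3 : ‖(c / x ^ 2 - s ^ 2 + ((‖s‖ ^ 2 : ℝ) : ℂ))‖ ≤ |c| * (x ^ 2)⁻¹ + 2 * |s.im| * ‖s‖ := by
      rw [← norm_sq_sub_sq s]
      have : (c / x ^ 2 - s ^ 2 + ((‖s‖ ^ 2 : ℝ) : ℂ))
          = (c : ℂ) * ((x : ℂ) ^ 2)⁻¹ + (((‖s‖ ^ 2 : ℝ) : ℂ) - s ^ 2) := by ring
      rw [this]
      refine (norm_add_le _ _).trans_eq ?_
      simp
    have h4 : inner ℝ (f' x) ((c / x ^ 2 - s ^ 2 + ((‖s‖ ^ 2 : ℝ) : ℂ)) * f x)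
        ≤ ‖f' x‖ * ((|c| * (x ^ 2)⁻¹ + 2 * |s.im| * ‖s‖) * ‖f x‖) := by
      refine (real_inner_le_norm _ _).trans ?_
      rw [norm_mul]
      gcongr
    have h5 : 2 * (‖s‖ * ‖f x‖ * ‖f' x‖) ≤ W x := by
      simp only [W]
      nlinarith [sq_nonneg (‖s‖ * ‖f x‖ - ‖f' x‖)]
    rw [e]
    calc _ ≤ 2 * (‖f' x‖ * ((|c| * (x ^ 2)⁻¹ + 2 * |s.im| * ‖s‖) * ‖f x‖)) := by gcongr
      _ = (2 * |s.im| + |c| / ‖s‖ * (x ^ 2)⁻¹) * (2 * (‖s‖ * ‖f x‖ * ‖f' x‖)) := by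
        field_simp; ring
      _ ≤ _ := by gcongr
  have hD : ∀ x, 0 < x → HasDerivAt (fun x => W x * Real.exp (p x))
      (W' x * Real.exp (p x) + W x *
        (Real.exp (p x) * (-(2 * |s.im|) + |c| / ‖s‖ * (-(x ^ 2)⁻¹)))) x :=
    fun x hx => (hW x hx).mul (hp x hx).exp
  have hanti : AntitoneOn (fun x => W x * Real.exp (p x)) (Set.Ici a) := by
    refine antitoneOn_of_deriv_nonpos (convex_Ici a)
      (fun x hx => (hD x (ha.trans_le hx)).continuousAt.continuousWithinAt) ?_ ?_
    · intro x hx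
      rw [interior_Ici] at hx
      exact (hD x (ha.trans hx)).differentiableAt.differentiableWithinAt
    · intro x hx
      rw [interior_Ici] at hx
      rw [(hD x (ha.trans hx)).deriv]
      have := mul_le_mul_of_nonneg_right (hbound x (ha.trans hx)) (Real.exp_pos (p x)).le
      linarith
  have key := hanti (Set.mem_Ici.2 le_rfl) (Set.mem_Ici.2 hab) hab
  have hb : 0 < b := ha.trans_le hab
  have hWa : 0 ≤ W a := by positivity
  change W b ≤ W a * _
  calc W b = W b * Real.exp (p b) * Real.exp (-p b) := by
        rw [mul_assoc, ← Real.exp_add]; simp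
    _ ≤ W a * Real.exp (p a) * Real.exp (-p b) := by gcongr
    _ = W a * Real.exp (p a - p b) := by rw [mul_assoc, ← Real.exp_add]; rfl
    _ ≤ _ := by
      gcongr
      have h6 : 0 ≤ |c| / ‖s‖ * b⁻¹ := by positivity
      have h7 : |c| / (‖s‖ * a) = |c| / ‖s‖ * a⁻¹ := by field_simp
      simp only [p]
      rw [h7]
      linarith

/-- Growth of Bessel solutions in the region `‖s‖ x ≥ 1`. -/
theorem BesselSol.norm_le_of_one_le {ν : ℝ} {s : ℂ} {g g₁ : ℝ → ℂ}
    (h : BesselSol ν (s ^ 2) g g₁) {a b : ℝ} (ha : 0 < a) (hsa : 1 ≤ ‖s‖ * a) (hab : a ≤ b) :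
    √b * ‖g b‖ ≤ Real.exp |ν ^ 2 - 1 / 4| * (√a * (2 * ‖g a‖ + ‖g₁ a‖ / (‖s‖ * a))) *
      Real.exp (|s.im| * (b - a)) := by
  have hs' : 0 < ‖s‖ := by
    rcases (norm_nonneg s).eq_or_lt with h0 | h0
    · rw [← h0] at hsa; norm_num at hsa
    · exact h0
  set c : ℝ := ν ^ 2 - 1 / 4
  have hsq : ∀ x : ℝ, 0 < x → HasDerivAt (fun x : ℝ => ((√x : ℝ) : ℂ)) (√x / (2 * x) : ℂ) x := by
    intro x hx
    refine (Real.hasDerivAt_sqrt hx.ne').ofReal_comp.congr_deriv ?_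
    have : √x / (2 * x) = 1 / (2 * √x) := by
      have := Real.sqrt_pos.2 hx
      field_simp
      rw [Real.sq_sqrt hx.le]
    exact_mod_cast this.symm
  have hsi : ∀ x : ℝ, 0 < x →
      HasDerivAt (fun x : ℝ => ((√x : ℝ) : ℂ) / x) (-(√x / (2 * x ^ 2)) : ℂ) x := by
    intro x hx
    have hx' : (x : ℂ) ≠ 0 := by exact_mod_cast hx.ne'
    refine ((hsq x hx).div (hasDerivAt_id' x).ofReal_comp hx').congr_deriv ?_
    field_simp
    push_cast
    ring
  -- The substitution `f = √x g` removes the first-order term and leaves `f'' = ((ν² - 1/4) / x² -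
  -- s²) f`.
  have h1 : ∀ x : ℝ, 0 < x → HasDerivAt (fun x => ((√x : ℝ) : ℂ) * g x)
      (((√x : ℝ) : ℂ) / x * (g x / 2 + g₁ x)) x := by
    intro x hx
    refine ((hsq x hx).mul (h x hx).1).congr_deriv ?_
    ring
  have h2 : ∀ x : ℝ, 0 < x → HasDerivAt (fun x : ℝ => ((√x : ℝ) : ℂ) / x * (g x / 2 + g₁ x))
      ((c / x ^ 2 - s ^ 2) * (((√x : ℝ) : ℂ) * g x)) x := by
    intro x hx
    have hx' : (x : ℂ) ≠ 0 := by exact_mod_cast hx.ne'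
    refine ((hsi x hx).mul (((h x hx).1.div_const 2).add (h x hx).2)).congr_deriv ?_
    simp only [c, Pi.add_apply]
    push_cast
    field_simp
    ring
  have key := energy_le (norm_pos_iff.1 hs') ha hab h1 h2
  have hb : 0 < b := ha.trans_le hab
  -- The energy is quadratic; the generous factor `2` makes the exponential the square of `exp |c| ·
  -- exp (|s.im| (b - a))`.
  have e1 : |c| / (‖s‖ * a) ≤ 2 * |c| := by
    have := div_le_self (abs_nonneg c) hsa
    linarith [abs_nonneg c]
  simp only [norm_mul, norm_div, Complex.norm_real, Real.norm_eq_abs, abs_of_pos ha,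
    abs_of_nonneg (Real.sqrt_nonneg _)] at key
  have e2 : ‖g a / 2 + g₁ a‖ ≤ ‖g a‖ + ‖g₁ a‖ := by
    refine (norm_add_le _ _).trans ?_
    rw [norm_div]
    have := norm_nonneg (g a)
    norm_num
  have e3 : √a / a * ‖g a / 2 + g₁ a‖ ≤ ‖s‖ * (√a * (‖g a‖ + ‖g₁ a‖ / (‖s‖ * a))) := by
    calc _ ≤ √a / a * (‖g a‖ + ‖g₁ a‖) := by gcongr
      _ = ‖s‖ * (√a * (‖g a‖ / (‖s‖ * a) + ‖g₁ a‖ / (‖s‖ * a))) := by field_simp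
      _ ≤ _ := by
        gcongr
        exact div_le_self (norm_nonneg _) hsa
  set T : ℝ := √a * (2 * ‖g a‖ + ‖g₁ a‖ / (‖s‖ * a))
  have e4 : (√a / a * ‖g a / 2 + g₁ a‖) ^ 2 + ‖s‖ ^ 2 * (√a * ‖g a‖) ^ 2 ≤ (‖s‖ * T) ^ 2 := by
    have hu : 0 ≤ ‖s‖ * (√a * ‖g a‖) := by positivity
    have hv : 0 ≤ √a / a * ‖g a / 2 + g₁ a‖ := by positivity
    have hT : ‖s‖ * T = ‖s‖ * (√a * (‖g a‖ + ‖g₁ a‖ / (‖s‖ * a))) + ‖s‖ * (√a * ‖g a‖) := by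
      simp only [T]; ring
    have : √a / a * ‖g a / 2 + g₁ a‖ + ‖s‖ * (√a * ‖g a‖) ≤ ‖s‖ * T := by rw [hT]; linarith
    calc _ ≤ (√a / a * ‖g a / 2 + g₁ a‖ + ‖s‖ * (√a * ‖g a‖)) ^ 2 := by
          nlinarith [mul_nonneg hu hv]
      _ ≤ _ := by gcongr
  have hT0 : 0 ≤ T := by positivity
  have e5 : (‖s‖ * (√b * ‖g b‖)) ^ 2 ≤
      (‖s‖ * (Real.exp |c| * T * Real.exp (|s.im| * (b - a)))) ^ 2 := by
    calc (‖s‖ * (√b * ‖g b‖)) ^ 2 = ‖s‖ ^ 2 * (√b * ‖g b‖) ^ 2 := by ring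
      _ ≤ _ := le_add_of_nonneg_left (sq_nonneg _)
      _ ≤ _ := key
      _ ≤ (‖s‖ * T) ^ 2 * Real.exp (2 * |s.im| * (b - a) + 2 * |c|) := by gcongr
      _ = _ := by
        have : Real.exp (2 * |s.im| * (b - a) + 2 * |c|) =
            (Real.exp |c| * Real.exp (|s.im| * (b - a))) ^ 2 := by
          rw [← Real.exp_add, sq, ← Real.exp_add]; congr 1; ring
        rw [this]; ring
  exact le_of_mul_le_mul_left ((pow_le_pow_iff_left₀ (by positivity) (by positivity)
    two_ne_zero).1 e5) hs'

/-- Growth of Bessel solutions vanishing at `y` in the region `‖z‖ x² ≤ 1`; here `Λ` is a primitive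
of `x ^ (-2ν-1)`. -/
theorem BesselSol.norm_le_of_le_one {ν : ℝ} (hν : 0 ≤ ν) {z : ℂ} {g g₁ : ℝ → ℂ}
    (h : BesselSol ν z g g₁) {x y : ℝ} (hy : 0 < y) (hyx : y ≤ x) (hz : ‖z‖ * x ^ 2 ≤ 1)
    (h0 : g y = 0) {Λ : ℝ → ℝ} (hΛ : ∀ t, 0 < t → HasDerivAt Λ (t ^ (-2 * ν - 1)) t)
    (hΛy : Λ y = 0) :
    ‖g x‖ ≤ 2 * (x ^ ν * y ^ ν * Λ x) * ‖g₁ y‖ ∧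
      ‖g₁ x‖ ≤ ((2 * ν + 2) * (x ^ ν * y ^ ν * Λ x) + 1) * ‖g₁ y‖ := by
  have hx : 0 < x := hy.trans_le hyx
  -- In these variables the equation is the system `w' = t^(-2ν-1) k`, `k' = -z t^(2ν+1) w`, which
  -- for `z = 0` is solved by constant `k`.
  set w : ℝ → ℂ := fun t => ((t ^ (-ν) : ℝ) : ℂ) * g t
  set k : ℝ → ℂ := fun t => ((t ^ ν : ℝ) : ℂ) * (g₁ t - ν * g t)
  have hrp : ∀ μ t : ℝ, 0 < t →
      HasDerivAt (fun t : ℝ => ((t ^ μ : ℝ) : ℂ)) (μ * ((t ^ μ : ℝ) : ℂ) / t) t := by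
    intro μ t ht
    refine (Real.hasDerivAt_rpow_const (Or.inl ht.ne')).ofReal_comp.congr_deriv ?_
    rw [Real.rpow_sub_one ht.ne']
    push_cast; ring
  have hw : ∀ t, 0 < t → HasDerivAt w (((t ^ (-2 * ν - 1) : ℝ) : ℂ) * k t) t := by
    intro t ht
    refine ((hrp (-ν) t ht).mul (h t ht).1).congr_deriv ?_
    have e : ((t ^ (-2 * ν - 1) : ℝ) : ℂ) * ((t ^ ν : ℝ) : ℂ) = ((t ^ (-ν) : ℝ) : ℂ) / t := by
      rw [← Complex.ofReal_mul, ← Real.rpow_add ht, ← Complex.ofReal_div, ← Real.rpow_sub_one ht.ne']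
      congr 2; ring
    simp only [k]
    rw [← mul_assoc, e]
    push_cast
    ring
  have hk : ∀ t, 0 < t → HasDerivAt k (-z * ((t ^ (2 * ν + 1) : ℝ) : ℂ) * w t) t := by
    intro t ht
    have ht' : (t : ℂ) ≠ 0 := by exact_mod_cast ht.ne'
    refine ((hrp ν t ht).mul ((h t ht).2.sub ((h t ht).1.const_mul (ν : ℂ)))).congr_deriv ?_
    have e : ((t ^ (2 * ν + 1) : ℝ) : ℂ) * ((t ^ (-ν) : ℝ) : ℂ) = ((t ^ ν : ℝ) : ℂ) * t := by
      rw [← Complex.ofReal_mul, ← Real.rpow_add ht, ← Complex.ofReal_mul, ← Real.rpow_add_one ht.ne']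
      congr 2; ring
    simp only [w]
    rw [mul_assoc (-z), ← mul_assoc _ _ (g t), e]
    simp only [Pi.sub_apply]
    field_simp
    ring
  have hwc : ContinuousOn w (Set.Icc y x) := fun t ht =>
    (hw t (hy.trans_le ht.1)).continuousAt.continuousWithinAt
  obtain ⟨m, hm, hmax⟩ := isCompact_Icc.exists_isMaxOn (Set.nonempty_Icc.2 hyx) hwc.norm
  set M := ‖w m‖
  have hM : ∀ t ∈ Set.Icc y x, ‖w t‖ ≤ M := fun t ht => hmax ht
  have hM0 : 0 ≤ M := norm_nonneg _
  have hky : ‖k y‖ = y ^ ν * ‖g₁ y‖ := by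
    simp only [k, h0, mul_zero, sub_zero, norm_mul, Complex.norm_real, Real.norm_eq_abs]
    rw [abs_of_nonneg (by positivity)]
  -- Integrate `k'` from `y`, with `w` replaced by its maximum `M`; `hwb` then integrates `w'` using
  -- this bound.
  have hkb : ∀ t ∈ Set.Icc y x, ‖k t‖ ≤ y ^ ν * ‖g₁ y‖ + ‖z‖ * M * t ^ (2 * ν + 2) := by
    intro t ht
    have ht0 : 0 < t := hy.trans_le ht.1
    have := (convex_Icc y t).norm_image_sub_le_of_norm_hasDerivWithin_le (f := k)
      (C := ‖z‖ * t ^ (2 * ν + 1) * M)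
      (fun u hu => (hk u (hy.trans_le hu.1)).hasDerivWithinAt) (fun u hu => ?_)
      (Set.left_mem_Icc.2 ht.1) (Set.right_mem_Icc.2 ht.1)
    · have h3 : ‖t - y‖ ≤ t := by
        rw [Real.norm_eq_abs, abs_of_nonneg (by linarith [ht.1])]; linarith
      have h4 : ‖k t‖ ≤ ‖k y‖ + ‖k t - k y‖ := by
        have := norm_add_le (k y) (k t - k y)
        rwa [add_sub_cancel] at this
      rw [hky] at h4
      refine h4.trans ?_
      gcongr
      refine this.trans ?_
      have e : t ^ (2 * ν + 2) = t ^ (2 * ν + 1) * t := by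
        rw [← Real.rpow_add_one ht0.ne']; congr 1; ring
      rw [e]
      calc _ ≤ ‖z‖ * t ^ (2 * ν + 1) * M * t := by gcongr
        _ = _ := by ring
    · have hu0 : 0 < u := hy.trans_le hu.1
      rw [norm_mul, norm_mul, norm_neg, Complex.norm_real, Real.norm_eq_abs,
        abs_of_nonneg (by positivity)]
      have h5 := hM u ⟨hu.1, hu.2.trans ht.2⟩
      have h6 := hu.2
      gcongr
  have hΛmono : MonotoneOn Λ (Set.Ici y) := by
    refine monotoneOn_of_deriv_nonneg (convex_Ici y)
      (fun t ht => (hΛ t (hy.trans_le ht)).continuousAt.continuousWithinAt) ?_ ?_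
    · intro t ht
      rw [interior_Ici] at ht
      exact (hΛ t (hy.trans ht)).differentiableAt.differentiableWithinAt
    · intro t ht
      rw [interior_Ici] at ht
      rw [(hΛ t (hy.trans ht)).deriv]
      have : 0 < t := hy.trans ht
      positivity
  have hwb : ∀ t ∈ Set.Icc y x, ‖w t‖ ≤ y ^ ν * ‖g₁ y‖ * Λ t + ‖z‖ * M * (t ^ 2 / 2) := by
    refine fun u hu => image_norm_le_of_norm_deriv_right_le_deriv_boundary' (f := w)
      (f' := fun t => ((t ^ (-2 * ν - 1) : ℝ) : ℂ) * k t)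
      (B := fun t => y ^ ν * ‖g₁ y‖ * Λ t + ‖z‖ * M * (t ^ 2 / 2))
      (B' := fun t => y ^ ν * ‖g₁ y‖ * t ^ (-2 * ν - 1) + ‖z‖ * M * t) hwc
      (fun t ht => (hw t (hy.trans_le ht.1)).hasDerivWithinAt) ?_ ?_ ?_ ?_ hu
    · simp only [w, h0, mul_zero, norm_zero, hΛy, zero_add]; positivity
    · intro t ht
      have ht0 : 0 < t := hy.trans_le ht.1
      exact ((hΛ t ht0).continuousAt.continuousWithinAt.const_mul _).add
        (by fun_prop)
    · intro t ht
      have ht0 : 0 < t := hy.trans_le ht.1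
      refine (((hΛ t ht0).const_mul _).add ((((hasDerivAt_id' t).pow 2).div_const 2).const_mul
        (‖z‖ * M))).hasDerivWithinAt.congr_deriv ?_
      simp
    · intro t ht
      have ht0 : 0 < t := hy.trans_le ht.1
      rw [norm_mul, Complex.norm_real, Real.norm_eq_abs, abs_of_nonneg (by positivity)]
      refine (mul_le_mul_of_nonneg_left (hkb t ⟨ht.1, ht.2.le⟩) (by positivity)).trans_eq ?_
      have e : t ^ (-2 * ν - 1) * t ^ (2 * ν + 2) = t := by
        rw [← Real.rpow_add ht0]; ring_nf; simp
      linear_combination (‖z‖ * M) * e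
  -- At the maximum point the `z` term is at most `M / 2` because `‖z‖ x² ≤ 1`, so it is absorbed on
  -- the left.
  have hMb : M ≤ 2 * (y ^ ν * ‖g₁ y‖ * Λ x) := by
    have h3 := hwb m hm
    have h4 : Λ m ≤ Λ x := hΛmono hm.1 (Set.mem_Ici.2 hyx) hm.2
    have h5 : ‖z‖ * M * (m ^ 2 / 2) ≤ M / 2 := by
      have h6 : m ^ 2 ≤ x ^ 2 := pow_le_pow_left₀ (hy.trans_le hm.1).le hm.2 2
      have h7 : ‖z‖ * m ^ 2 ≤ 1 := (mul_le_mul_of_nonneg_left h6 (norm_nonneg z)).trans hz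
      nlinarith
    have h6 : y ^ ν * ‖g₁ y‖ * Λ m ≤ y ^ ν * ‖g₁ y‖ * Λ x := by gcongr
    change M ≤ _ at h3
    linarith
  have hgx : ‖g x‖ ≤ x ^ ν * M := by
    have h3 := hM x (Set.right_mem_Icc.2 hyx)
    have h4 : g x = ((x ^ ν : ℝ) : ℂ) * w x := by
      simp only [w]
      rw [← mul_assoc, ← Complex.ofReal_mul, ← Real.rpow_add hx]; simp
    rw [h4, norm_mul, Complex.norm_real, Real.norm_eq_abs, abs_of_nonneg (by positivity)]
    gcongr
  have hb : x ^ ν * M ≤ 2 * (x ^ ν * y ^ ν * Λ x) * ‖g₁ y‖ := by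
    calc _ ≤ x ^ ν * (2 * (y ^ ν * ‖g₁ y‖ * Λ x)) := by gcongr
      _ = _ := by ring
  refine ⟨hgx.trans hb, ?_⟩
  have hg1 : g₁ x = ν * g x + ((x ^ (-ν) : ℝ) : ℂ) * k x := by
    simp only [k]
    rw [← mul_assoc, ← Complex.ofReal_mul, ← Real.rpow_add hx]; simp
  have h3 := hkb x (Set.right_mem_Icc.2 hyx)
  have h4 : x ^ (-ν) * y ^ ν ≤ 1 := by
    rw [Real.rpow_neg hx.le, inv_mul_le_one₀ (by positivity)]
    gcongr
  have e5 : x ^ (-ν) * x ^ (2 * ν + 2) = x ^ ν * x ^ 2 := by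
    rw [← Real.rpow_add hx, ← Real.rpow_natCast x 2, ← Real.rpow_add hx]; congr 1; push_cast; ring
  calc ‖g₁ x‖ ≤ ν * ‖g x‖ + x ^ (-ν) * ‖k x‖ := by
        rw [hg1]
        refine (norm_add_le _ _).trans_eq ?_
        rw [norm_mul, norm_mul, Complex.norm_real, Complex.norm_real, Real.norm_eq_abs,
          Real.norm_eq_abs, abs_of_nonneg hν, abs_of_nonneg (by positivity : 0 ≤ x ^ (-ν))]
    _ ≤ ν * (x ^ ν * M) + x ^ (-ν) * (y ^ ν * ‖g₁ y‖ + ‖z‖ * M * x ^ (2 * ν + 2)) := by gcongr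
    _ = ν * (x ^ ν * M) + (x ^ (-ν) * y ^ ν) * ‖g₁ y‖ + (‖z‖ * x ^ 2) * (x ^ ν * M) := by
      linear_combination (‖z‖ * M) * e5
    _ ≤ ν * (x ^ ν * M) + 1 * ‖g₁ y‖ + 1 * (x ^ ν * M) := by gcongr
    _ = (ν + 1) * (x ^ ν * M) + ‖g₁ y‖ := by ring
    _ ≤ (ν + 1) * (2 * (x ^ ν * y ^ ν * Λ x) * ‖g₁ y‖) + ‖g₁ y‖ := by gcongr
    _ = _ := by ring

/-! ### Principal branches, and `φ_l`, `θ_l` as Frobenius series. -/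

theorem csqrt_sq (z : ℂ) : csqrt z ^ 2 = z := by
  simp [csqrt]

theorem csqrt_ne_zero {z : ℂ} (hz : z ≠ 0) : csqrt z ≠ 0 := fun h => hz <| by
  rw [← csqrt_sq z, h]; simp

theorem norm_csqrt (z : ℂ) : ‖csqrt z‖ = √‖z‖ := by
  conv_rhs => rw [← csqrt_sq z, norm_pow, Real.sqrt_sq (norm_nonneg _)]

/-- Halving the argument keeps it within `(-π, π]`, so no multiple of `2πi` appears. -/
theorem log_csqrt {z : ℂ} (hz : z ≠ 0) : Complex.log (csqrt z) = Complex.log z / 2 := by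
  have h1 := Complex.neg_pi_lt_log_im z
  have h2 := Complex.log_im_le_pi z
  have e : (Complex.log z * (1 / 2)).im = (Complex.log z).im / 2 := by
    rw [mul_one_div, Complex.div_ofNat_im]
  rw [csqrt, Complex.cpow_def_of_ne_zero hz, Complex.log_exp]
  · ring
  · rw [e]; linarith [Real.pi_pos]
  · rw [e]; linarith [Real.pi_pos]

theorem log_csqrt_mul {z : ℂ} (hz : z ≠ 0) {x : ℝ} (hx : 0 < x) :
    Complex.log (csqrt z * x / 2) = Complex.log z / 2 + (Real.log (x / 2) : ℝ) := by
  have : csqrt z * x / 2 = csqrt z * ((x / 2 : ℝ) : ℂ) := by push_cast; ring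
  rw [this, Complex.log_mul_ofReal _ (by positivity) _ (csqrt_ne_zero hz), log_csqrt hz]
  ring

theorem csqrt_mul_cpow {z : ℂ} (hz : z ≠ 0) {x : ℝ} (hx : 0 < x) (ν : ℝ) :
    (csqrt z * x / 2) ^ (ν : ℂ) = z ^ (ν / 2 : ℂ) * (((x / 2) ^ ν : ℝ) : ℂ) := by
  have h0 : csqrt z * x / 2 ≠ 0 := by
    have : (x : ℂ) ≠ 0 := by exact_mod_cast hx.ne'
    simp [csqrt_ne_zero hz, this]
  rw [Complex.cpow_def_of_ne_zero h0, log_csqrt_mul hz hx, Complex.cpow_def_of_ne_zero hz,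
    Real.rpow_def_of_pos (by positivity), Complex.ofReal_exp, ← Complex.exp_add]
  congr 1
  push_cast
  ring

/-- The coefficients of the Bessel series. -/
noncomputable def besselCoeff (ν : ℝ) (k : ℕ) : ℂ :=
  (-1) ^ k / ((k.factorial : ℂ) * Complex.Gamma (ν + k + 1))

theorem besselCoeff_succ {ν : ℝ} (k : ℕ) (h : ν + k + 1 ≠ 0) :
    ((k : ℂ) + 1) * (k + 1 + ν) * besselCoeff ν (k + 1) = -besselCoeff ν k := by
  have h' : (ν + k + 1 : ℂ) ≠ 0 := by exact_mod_cast h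
  have hk : (k + 1 : ℂ) ≠ 0 := by exact_mod_cast k.succ_ne_zero
  have e : Complex.Gamma (ν + (k + 1 : ℕ) + 1) = (ν + k + 1) * Complex.Gamma (ν + k + 1) := by
    rw [← Complex.Gamma_add_one _ h']; push_cast; ring_nf
  have h2 : (k + 1 + ν : ℂ) ≠ 0 := by convert h' using 1; ring
  rw [besselCoeff, besselCoeff, e, Nat.factorial_succ, pow_succ]
  push_cast
  have e2 : (ν + k + 1 : ℂ) = k + 1 + ν := by ring
  rw [e2]
  generalize Complex.Gamma (k + 1 + ν) = G
  have hA : ((k : ℂ) + 1) * (k + 1 + ν) ≠ 0 := mul_ne_zero hk h2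
  have e3 : ((k : ℂ) + 1) * k.factorial * ((k + 1 + ν) * G)
      = ((k : ℂ) + 1) * (k + 1 + ν) * (k.factorial * G) := by ring
  rw [e3, ← mul_div_assoc, mul_div_mul_left _ _ hA]
  ring

theorem besselJ_csqrt {z : ℂ} (hz : z ≠ 0) {x : ℝ} (hx : 0 < x) (ν : ℝ) :
    besselJ ν (csqrt z * x) = z ^ (ν / 2 : ℂ) * frob ν (besselCoeff ν) z x := by
  rw [besselJ, csqrt_mul_cpow hz hx, frob, mul_assoc, mul_pow, csqrt_sq]
  congr 2
  refine tsum_congr fun k => ?_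
  rw [besselCoeff]; ring

theorem sqrt_pi_mul_div (x : ℝ) (hx : 0 < x) : √(Real.pi * x / 2) = √x * √(Real.pi / 2) := by
  rw [← Real.sqrt_mul hx.le]; congr 1; ring

theorem psum_zero (a : ℕ → ℂ) : psum a 0 = a 0 := by
  rw [psum, tsum_eq_single 0 (fun k hk => by simp [hk])]; simp

theorem frob_zero (μ : ℝ) (a : ℕ → ℂ) (x : ℝ) :
    frob μ a 0 x = (((x / 2) ^ μ : ℝ) : ℂ) * a 0 := by
  simp [frob, psum_zero]

theorem besselCoeff_zero (ν : ℝ) : besselCoeff ν 0 = ((1 / Real.Gamma (ν + 1) : ℝ) : ℂ) := by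
  rw [besselCoeff, Nat.cast_zero, add_zero, ← Complex.ofReal_one, ← Complex.ofReal_add,
    Complex.Gamma_ofReal]
  simp

/-- The prefactor `z ^ (-ν/2)` cancels the branch power in `J_ν(√z x)`. After that one expression
covers `z = 0` as well. -/
theorem phi_eq {l ν : ℝ} (hl : l = ν - 1 / 2) (z : ℂ) {x : ℝ} (hx : 0 < x) :
    phi l z x = (√x : ℂ) * ((√(Real.pi / 2) : ℂ) * frob ν (besselCoeff ν) z x) := by
  subst hl
  have hsx : 0 < √x := Real.sqrt_pos.2 hx
  by_cases hz : z = 0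
  · subst hz
    rw [phi, if_pos rfl, frob_zero, besselCoeff_zero, ← Complex.ofReal_mul, ← Complex.ofReal_mul,
      ← Complex.ofReal_mul]
    congr 1
    have e1 : ν - 1 / 2 + 3 / 2 = ν + 1 := by ring
    have e2 : ν - 1 / 2 + 1 = ν + 1 / 2 := by ring
    rw [e1, e2, Real.rpow_add hx, Real.rpow_add two_pos, ← Real.sqrt_eq_rpow, ← Real.sqrt_eq_rpow,
      Real.div_rpow hx.le two_pos.le, Real.sqrt_div Real.pi_pos.le]
    ring
  · have e : z ^ (-(2 * ((ν - 1 / 2 : ℝ) : ℂ) + 1) / 4) * z ^ (ν / 2 : ℂ) = 1 := by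
      rw [← Complex.cpow_add _ _ hz]
      push_cast
      ring_nf
      simp
    rw [phi, if_neg hz, sub_add_cancel, besselJ_csqrt hz hx, sqrt_pi_mul_div x hx]
    push_cast at e ⊢
    linear_combination ((√x : ℂ) * ((√(Real.pi / 2) : ℂ) * frob ν (besselCoeff ν) z x)) * e

/-- For `z ≠ 0` the powers of `z` cancel. At `z = 0` the prescribed value agrees by the reflection
formula `Γ(ν) Γ(1 - ν) = π / sin (πν)`. -/
theorem theta_eq_of_not_nat {l ν : ℝ} (hl : l = ν - 1 / 2) (hν : 0 ≤ ν)
    (h : ¬ ∃ n : ℕ, ν = n) (z : ℂ) {x : ℝ} (hx : 0 < x) :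
    theta l z x = (√x : ℂ) * (((√(Real.pi / 2) / Real.sin (ν * Real.pi) : ℝ) : ℂ) *
      frob (-ν) (besselCoeff (-ν)) z x) := by
  subst hl
  have hsx : 0 < √x := Real.sqrt_pos.2 hx
  have hν0 : 0 < ν := hν.lt_of_ne fun h0 => h ⟨0, by simp [← h0]⟩
  by_cases hz : z = 0
  · subst hz
    have hl : ν - 1 / 2 ≠ -1 / 2 := by intro h; linarith
    rw [theta, if_pos rfl, if_neg hl, frob_zero, besselCoeff_zero, ← Complex.ofReal_mul,
      ← Complex.ofReal_mul, ← Complex.ofReal_mul]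
    congr 1
    have e1 : ν - 1 / 2 + 3 / 2 = ν + 1 := by ring
    have e2 : ν - 1 / 2 + 1 = ν + 1 / 2 := by ring
    have e3 : -(ν - 1 / 2) = -ν + 1 / 2 := by ring
    have hr := Real.Gamma_mul_Gamma_one_sub ν
    have hs : Real.sin (ν * Real.pi) ≠ 0 := by
      rw [Ne, Real.sin_eq_zero_iff]
      rintro ⟨m, hm⟩
      have hm' := mul_right_cancel₀ Real.pi_ne_zero hm
      have : 0 ≤ m := by
        have : (0 : ℝ) ≤ m := by rw [hm']; exact hν
        exact_mod_cast this
      exact h ⟨m.toNat, by rw [← hm']; exact_mod_cast (Int.toNat_of_nonneg this).symm⟩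
    rw [mul_comm Real.pi] at hr
    have hg : Real.Gamma ν ≠ 0 := (Real.Gamma_pos_of_pos hν0).ne'
    have hg1 : Real.Gamma (1 - ν) = Real.pi / (Real.sin (ν * Real.pi) * Real.Gamma ν) := by
      field_simp at hr ⊢; linarith
    rw [e1, e2, e3, Real.rpow_add hx, Real.rpow_add two_pos, ← Real.sqrt_eq_rpow,
      ← Real.sqrt_eq_rpow, Real.div_rpow hx.le two_pos.le, Real.sqrt_div Real.pi_pos.le,
      Real.Gamma_add_one hν0.ne', neg_add_eq_sub, hg1, Real.rpow_neg two_pos.le]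
    have h2 : (2 : ℝ) ^ ν ≠ 0 := by positivity
    have hp : √Real.pi ≠ 0 := by positivity
    have e4 : √Real.pi * √Real.pi = Real.pi := Real.mul_self_sqrt Real.pi_pos.le
    have e5 : √2 * √2 = (2 : ℝ) := Real.mul_self_sqrt two_pos.le
    have e6 : 2 * (ν - 1 / 2) + 1 = 2 * ν := by ring
    rw [e6]
    field_simp
    rw [sq, e5, sq, e4, mul_comm]
  · have e : z ^ ((2 * ((ν - 1 / 2 : ℝ) : ℂ) + 1) / 4) * z ^ (((-ν : ℝ) : ℂ) / 2 : ℂ) = 1 := by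
      rw [← Complex.cpow_add _ _ hz]
      push_cast
      ring_nf
      simp
    have e2 : -(ν - 1 / 2) - 1 / 2 = -ν := by ring
    rw [theta, if_neg hz, sub_add_cancel, if_neg h, e2, besselJ_csqrt hz hx, sqrt_pi_mul_div x hx]
    push_cast at e ⊢
    linear_combination ((√x : ℂ) * ((√(Real.pi / 2) : ℂ) / Complex.sin (ν * Real.pi)
      * frob (-ν) (besselCoeff (-ν)) z x)) * e

/-! ### Integer order: the Neumann function. -/

/-- The coefficients of the polynomial part of the Neumann function. -/
noncomputable def neumannPolyCoeff (n k : ℕ) : ℂ :=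
  if k < n then ((n - k - 1).factorial : ℂ) / (k.factorial : ℂ) else 0

/-- The coefficients of the power series part of the Neumann function. -/
noncomputable def neumannCoeff (n k : ℕ) : ℂ :=
  ((harmonic k : ℂ) + (harmonic (n + k) : ℂ) - 2 * (Real.eulerMascheroniConstant : ℂ)) *
    besselCoeff n k

/-- A solution of Bessel's equation of order `n` with a singularity at `0`. -/
noncomputable def neumannSol (n : ℕ) (z : ℂ) (x : ℝ) : ℂ :=
  frob (-n) (neumannPolyCoeff n) z x + z ^ n * (frob n (neumannCoeff n) z x
    - 2 * (Real.log (x / 2) : ℝ) * frob n (besselCoeff n) z x)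

theorem besselCoeff_natCast (n k : ℕ) :
    besselCoeff n k = (-1) ^ k / ((k.factorial : ℂ) * ((n + k).factorial : ℂ)) := by
  rw [besselCoeff, ← Complex.Gamma_nat_eq_factorial (n + k)]
  push_cast
  rfl

theorem psum_neumannPolyCoeff (n : ℕ) (t : ℂ) : psum (neumannPolyCoeff n) t =
    ∑ k ∈ Finset.range n, ((n - k - 1).factorial : ℂ) / (k.factorial : ℂ) * t ^ k := by
  rw [psum, tsum_eq_sum (s := Finset.range n)]
  · refine Finset.sum_congr rfl fun k hk => ?_
    rw [neumannPolyCoeff, if_pos (Finset.mem_range.1 hk)]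
  · intro k hk
    rw [neumannPolyCoeff, if_neg (by simpa using hk), zero_mul]

/-- The `(2/π) log (√z x / 2)` inside `Y_n` contributes `(1/π) log z`, exactly what is subtracted;
only `log (x/2)` survives. -/
theorem neumannY_csqrt {z : ℂ} (hz : z ≠ 0) {x : ℝ} (hx : 0 < x) (n : ℕ) :
    z ^ (n / 2 : ℂ) * (neumannY n (csqrt z * x)
        - 1 / (Real.pi : ℂ) * Complex.log z * besselJ n (csqrt z * x))
      = -(1 / (Real.pi : ℂ)) * neumannSol n z x := by
  have hx2 : (csqrt z * x) ^ 2 / 4 = z * x ^ 2 / 4 := by rw [mul_pow, csqrt_sq]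
  have hw : (csqrt z * x / 2) ^ n = z ^ (n / 2 : ℂ) * (((x / 2) ^ (n : ℝ) : ℝ) : ℂ) := by
    have := csqrt_mul_cpow hz hx n
    rwa [Complex.ofReal_natCast, Complex.cpow_natCast] at this
  have hn : z ^ (n / 2 : ℂ) * z ^ (n / 2 : ℂ) = z ^ n := by
    rw [← Complex.cpow_add _ _ hz, add_halves, Complex.cpow_natCast]
  have hz0 : z ^ (n / 2 : ℂ) ≠ 0 := by simp [Complex.cpow_eq_zero_iff, hz]
  have hs : ∑' k : ℕ, ((harmonic k : ℂ) + (harmonic (n + k) : ℂ)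
          - 2 * (Real.eulerMascheroniConstant : ℂ)) *
        ((-1) ^ k * (z * x ^ 2 / 4) ^ k / ((k.factorial : ℂ) * ((n + k).factorial : ℂ)))
      = psum (neumannCoeff n) (z * x ^ 2 / 4) := by
    refine tsum_congr fun k => ?_
    rw [neumannCoeff, besselCoeff_natCast]; ring
  have hJ := besselJ_csqrt hz hx n
  have hp : (Real.pi : ℂ) ≠ 0 := by exact_mod_cast Real.pi_ne_zero
  push_cast at hJ
  rw [neumannY, hx2, hs, ← psum_neumannPolyCoeff, log_csqrt_mul hz hx, hw, mul_inv]
  have hr : (((x / 2) ^ (n : ℝ) : ℝ) : ℂ) ≠ 0 := by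
    exact_mod_cast (by positivity : (x / 2) ^ (n : ℝ) ≠ 0)
  rw [hJ]
  simp only [neumannSol, frob, ← hn, Real.rpow_neg (by positivity : 0 ≤ x / 2)]
  push_cast at hr ⊢
  field_simp
  ring

theorem theta_eq_of_nat {l : ℝ} {n : ℕ} (hl : l = n - 1 / 2) (z : ℂ) {x : ℝ} (hx : 0 < x) :
    theta l z x = (√x : ℂ) * (((√(Real.pi / 2) / Real.pi : ℝ) : ℂ) * neumannSol n z x) := by
  subst hl
  have hsx : 0 < √x := Real.sqrt_pos.2 hx
  have hp : √Real.pi ≠ 0 := by positivity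
  have e4 : √Real.pi * √Real.pi = Real.pi := Real.mul_self_sqrt Real.pi_pos.le
  have e5 : √2 * √2 = (2 : ℝ) := Real.mul_self_sqrt two_pos.le
  by_cases hz : z = 0
  · subst hz
    rw [theta, if_pos rfl, neumannSol, frob_zero, frob_zero, frob_zero]
    rcases n with _ | n
    · rw [if_pos (by norm_num), Real.log_div hx.ne' two_ne_zero]
      have : √(2 * x / Real.pi) = √x * (√(Real.pi / 2) / Real.pi) * 2 := by
        rw [Real.sqrt_div (by positivity), Real.sqrt_mul two_pos.le, Real.sqrt_div Real.pi_pos.le]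
        nth_rw 3 [← e4]
        nth_rw 3 [← e5]
        field_simp
      rw [this]
      simp [neumannPolyCoeff, neumannCoeff, besselCoeff]
      ring
    · have hn : ((n + 1 : ℕ) : ℝ) - 1 / 2 ≠ -1 / 2 := by
        have := n.cast_nonneg (α := ℝ)
        push_cast; intro h; linarith
      rw [if_neg hn, zero_pow n.succ_ne_zero, zero_mul, add_zero]
      have e0 : neumannPolyCoeff (n + 1) 0 = ((n.factorial : ℝ) : ℂ) := by
        simp [neumannPolyCoeff]
      rw [e0, ← Complex.ofReal_mul, ← Complex.ofReal_mul, ← Complex.ofReal_mul]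
      congr 1
      have e1 : ((n + 1 : ℕ) : ℝ) - 1 / 2 + 3 / 2 = ((n + 1 : ℕ) : ℝ) + 1 := by ring
      have e2 : ((n + 1 : ℕ) : ℝ) - 1 / 2 + 1 = ((n + 1 : ℕ) : ℝ) + 1 / 2 := by ring
      have e3 : -(((n + 1 : ℕ) : ℝ) - 1 / 2) = -((n + 1 : ℕ) : ℝ) + 1 / 2 := by ring
      rw [e1, e2, e3, Real.rpow_add hx, Real.rpow_add two_pos, ← Real.sqrt_eq_rpow,
        ← Real.sqrt_eq_rpow, Real.div_rpow hx.le two_pos.le, Real.sqrt_div Real.pi_pos.le,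
        Real.Gamma_nat_eq_factorial, Nat.factorial_succ, Real.rpow_neg two_pos.le]
      have h2 : (2 : ℝ) ^ ((n + 1 : ℕ) : ℝ) ≠ 0 := by positivity
      have e6 : 2 * (((n + 1 : ℕ) : ℝ) - 1 / 2) + 1 = 2 * (n + 1 : ℕ) := by ring
      rw [e6]
      generalize (2 : ℝ) ^ ((n + 1 : ℕ) : ℝ) = T at *
      have hn0 : ((n + 1 : ℕ) : ℝ) ≠ 0 := by positivity
      nth_rw 3 [← e4]
      push_cast at hn0 ⊢
      field_simp
      rw [sq, e5]
  · have h : ∃ m : ℕ, (n : ℝ) - 1 / 2 + 1 / 2 = m := ⟨n, by ring⟩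
    rw [theta, if_neg hz, if_pos h, sub_add_cancel, Nat.floor_natCast, sqrt_pi_mul_div x hx]
    have e : (2 * (((n : ℝ) - 1 / 2 : ℝ) : ℂ) + 1) / 4 = n / 2 := by push_cast; ring
    rw [e]
    have := neumannY_csqrt hz hx n
    push_cast at this ⊢
    linear_combination (-(√x * √(Real.pi / 2) : ℂ)) * this

theorem besselCoeff_recurrence {ν : ℝ} (hν : 0 ≤ ν) (k : ℕ) :
    ((k : ℂ) + 1) * (k + 1 + ν) * besselCoeff ν (k + 1) = -besselCoeff ν k :=
  besselCoeff_succ k (by positivity)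

theorem harmonic_le (k : ℕ) : ‖(harmonic k : ℂ)‖ ≤ k := by
  induction k with
  | zero => simp
  | succ k ih =>
    rw [harmonic_succ]
    push_cast
    refine (norm_add_le _ _).trans (add_le_add ih ?_)
    rw [norm_inv]
    refine inv_le_one_of_one_le₀ ?_
    have : ((k : ℂ) + 1) = ((k + 1 : ℕ) : ℂ) := by push_cast; rfl
    rw [this, Complex.norm_natCast]
    exact_mod_cast k.succ_pos

theorem entireCoeff_neumannCoeff (n : ℕ) : EntireCoeff (neumannCoeff n) := by
  have ha := entireCoeff_of_recurrence (besselCoeff_recurrence (n.cast_nonneg (α := ℝ)))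
  -- By `H_k ≤ k` the digamma factor is at most `A + 2k`.
  set A : ℝ := n + 2 * |Real.eulerMascheroniConstant|
  refine (ha.affine_mul (A : ℂ) 2).of_norm_le fun k => ?_
  rw [neumannCoeff, norm_mul, norm_mul]
  gcongr
  have e : (A : ℂ) + 2 * k = ((A + 2 * k : ℝ) : ℂ) := by push_cast; ring
  rw [e, Complex.norm_real, Real.norm_eq_abs, abs_of_nonneg (by positivity)]
  have h1 := harmonic_le k
  have h2 := harmonic_le (n + k)
  push_cast at h2
  refine (norm_sub_le _ _).trans ?_
  have h3 := norm_add_le (harmonic k : ℂ) (harmonic (n + k) : ℂ)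
  rw [norm_mul, Complex.norm_real, Real.norm_eq_abs]
  simp only [A]
  norm_num
  linarith

theorem entireCoeff_neumannPolyCoeff (n : ℕ) : EntireCoeff (neumannPolyCoeff n) :=
  entireCoeff_of_finite_support n fun k hk => by rw [neumannPolyCoeff, if_neg (by omega)]

theorem entireCoeff_ite (n : ℕ) (e : ℂ) : EntireCoeff fun k => if k = n then e else 0 :=
  entireCoeff_of_finite_support (n + 1) fun k hk => if_neg (by omega)

/-- The recurrence for exponent `-n` holds below index `n` and breaks there, leaving the defect `4
(n / n!) tⁿ`. Writing `n / n!` rather than `1 / (n - 1)!` makes it vanish for `n = 0`. -/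
theorem psum_neumannPolyCoeff_sq (n : ℕ) (t : ℂ) :
    psum (fun k => (((-n : ℝ) : ℂ) + 2 * k) * ((((-n : ℝ) : ℂ) + 2 * k) * neumannPolyCoeff n k)) t
      = n ^ 2 * psum (neumannPolyCoeff n) t - 4 * (t * psum (neumannPolyCoeff n) t)
        + 4 * (n / n.factorial * t ^ n) := by
  have hα := entireCoeff_neumannPolyCoeff n
  set e : ℂ := n / n.factorial
  set c : ℕ → ℂ := fun k => (if k = n then e else 0) - k * (k - n) * neumannPolyCoeff n k
  have hc : EntireCoeff c := by
    convert (entireCoeff_ite n e).add ((hα.affine_mul n (-1)).natCast_mul) using 2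
    simp only [c]; ring
  have h1 : t * psum (neumannPolyCoeff n) t = psum c t := by
    refine mul_psum hα ?_ (fun k => ?_) t
    · rcases n with _ | n <;> simp [c, e]
    · simp only [c]
      rcases lt_trichotomy (k + 1) n with h | h | h
      · rw [if_neg h.ne, neumannPolyCoeff, neumannPolyCoeff, if_pos h, if_pos (by omega)]
        obtain ⟨m, rfl⟩ := Nat.exists_eq_add_of_lt h
        have e1 : k + 1 + m + 1 - (k + 1) - 1 = m := by omega
        have e2 : k + 1 + m + 1 - k - 1 = m + 1 := by omega
        rw [e1, e2, Nat.factorial_succ, Nat.factorial_succ]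
        have : (k.factorial : ℂ) ≠ 0 := by exact_mod_cast k.factorial_ne_zero
        have : (k + 1 : ℂ) ≠ 0 := by exact_mod_cast k.succ_ne_zero
        push_cast
        field_simp
        ring
      · rw [if_pos h, neumannPolyCoeff, neumannPolyCoeff, if_neg (by omega), if_pos (by omega)]
        subst h
        have : (k.factorial : ℂ) ≠ 0 := by exact_mod_cast k.factorial_ne_zero
        have : (k + 1 : ℂ) ≠ 0 := by exact_mod_cast k.succ_ne_zero
        simp only [e, Nat.factorial_succ]
        push_cast
        simp
        field_simp
      · rw [if_neg h.ne', neumannPolyCoeff, neumannPolyCoeff, if_neg (by omega),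
          if_neg (by omega)]
        simp
  have h2 : n / n.factorial * t ^ n = psum (fun k => if k = n then e else 0) t := by
    rw [psum_eq_single n (fun k hk => if_neg hk), if_pos rfl]
  rw [h1, h2, sub_eq_add_neg, ← neg_mul, ← psum_const_mul, ← psum_const_mul, ← psum_const_mul,
    ← psum_add (hα.const_mul _) (hc.const_mul _),
    ← psum_add ((hα.const_mul _).add (hc.const_mul _)) ((entireCoeff_ite n e).const_mul _)]
  congr 1
  ext k
  simp only [c]
  push_cast
  ring

/-- The harmonic increments give `k (k + n) (1/k + 1/(n + k)) = n + 2k`, which matches the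
first-order term produced when `(x d/dx)²` hits the logarithm. The defect at index `0` is to cancel
that of the polynomial part. -/
theorem psum_neumannCoeff_sq (n : ℕ) (t : ℂ) :
    psum (fun k => (((n : ℝ) : ℂ) + 2 * k) * ((((n : ℝ) : ℂ) + 2 * k) * neumannCoeff n k)) t
      - 4 * psum (fun k => (((n : ℝ) : ℂ) + 2 * k) * besselCoeff n k) t
      = n ^ 2 * psum (neumannCoeff n) t - 4 * (t * psum (neumannCoeff n) t)
        - 4 * (n / n.factorial) := by
  have ha := entireCoeff_of_recurrence (besselCoeff_recurrence (n.cast_nonneg (α := ℝ)))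
  have hσ := entireCoeff_neumannCoeff n
  set e : ℂ := n / n.factorial
  set c : ℕ → ℂ := fun k => (n + 2 * k) * besselCoeff n k - k * (k + n) * neumannCoeff n k
    - (if k = 0 then e else 0)
  have hda : EntireCoeff fun k : ℕ => (((n : ℝ) : ℂ) + 2 * k) * besselCoeff n k :=
    ha.affine_mul _ _
  have hc : EntireCoeff c := by
    convert (hda.add ((hσ.affine_mul n 1).natCast_mul.const_mul (-1))).add
      ((entireCoeff_ite 0 e).const_mul (-1)) using 2
    simp only [c]; push_cast; ring
  have h1 : t * psum (neumannCoeff n) t = psum c t := by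
    refine mul_psum hσ ?_ (fun k => ?_) t
    · simp only [c, besselCoeff_natCast, e]
      simp
      ring
    · simp only [c]
      have hk := besselCoeff_recurrence (n.cast_nonneg (α := ℝ)) k
      rw [if_neg k.succ_ne_zero, neumannCoeff, neumannCoeff, ← add_assoc, harmonic_succ,
        harmonic_succ]
      have h2 : (k + 1 : ℂ) ≠ 0 := by exact_mod_cast k.succ_ne_zero
      have h3 : (n + k + 1 : ℂ) ≠ 0 := by exact_mod_cast (n + k).succ_ne_zero
      push_cast at hk ⊢
      generalize (harmonic k : ℂ) = H at *
      generalize (harmonic (n + k) : ℂ) = H' at *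
      generalize (Real.eulerMascheroniConstant : ℂ) = γ at *
      have h4 : ((k : ℂ) + 1) * (k + 1 + n) * ((k + 1 : ℂ)⁻¹ + (n + k + 1 : ℂ)⁻¹)
          = n + 2 * (k + 1) := by
        field_simp; ring
      linear_combination (-(H + H' - 2 * γ)) * hk - besselCoeff n (k + 1) * h4
  have h2 : e = psum (fun k => if k = 0 then e else 0) t := by
    rw [psum_eq_single 0 (fun k hk => if_neg hk), if_pos rfl, pow_zero, mul_one]
  rw [h1, sub_eq_iff_eq_add, sub_eq_add_neg, sub_eq_add_neg, ← neg_mul, ← neg_mul]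
  nth_rw 1 [h2]
  rw [← psum_const_mul, ← psum_const_mul, ← psum_const_mul, ← psum_const_mul,
    ← psum_add (hσ.const_mul _) (hc.const_mul _),
    ← psum_add ((hσ.const_mul _).add (hc.const_mul _)) ((entireCoeff_ite 0 e).const_mul _),
    ← psum_add (((hσ.const_mul _).add (hc.const_mul _)).add ((entireCoeff_ite 0 e).const_mul _))
      (hda.const_mul _)]
  congr 1
  ext k
  simp only [c]
  push_cast
  ring

/-- The derivative `x d/dx` of `neumannSol`. -/
noncomputable def neumannSolDeriv (n : ℕ) (z : ℂ) (x : ℝ) : ℂ :=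
  frob (-n) (fun k => (((-n : ℝ) : ℂ) + 2 * k) * neumannPolyCoeff n k) z x
    + z ^ n * (frob n (fun k => (((n : ℝ) : ℂ) + 2 * k) * neumannCoeff n k) z x
      - 2 * frob n (besselCoeff n) z x
      - 2 * (Real.log (x / 2) : ℝ) *
        frob n (fun k => (((n : ℝ) : ℂ) + 2 * k) * besselCoeff n k) z x)

theorem pow_eq_mul_rpow (n : ℕ) (z : ℂ) {x : ℝ} :
    (z * x ^ 2 / 4) ^ n = z ^ n * (((x / 2) ^ (n : ℝ) : ℝ) : ℂ) ^ 2 := by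
  rw [Real.rpow_natCast]
  push_cast
  rw [← pow_mul, mul_comm n 2, pow_mul, ← mul_pow]
  congr 1; ring

theorem rpow_neg_mul_cancel (ν : ℝ) {x : ℝ} (hx : 0 < x) :
    (((x / 2) ^ (-ν) : ℝ) : ℂ) * (((x / 2) ^ ν : ℝ) : ℂ) = 1 := by
  rw [← Complex.ofReal_mul, ← Real.rpow_add (by positivity)]; simp

theorem besselSol_neumannSol (n : ℕ) (z : ℂ) :
    BesselSol n z (neumannSol n z) (neumannSolDeriv n z) := by
  have hB := besselSol_frob (besselCoeff_recurrence (n.cast_nonneg (α := ℝ))) z (μ := n) rfl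
  have hσ := entireCoeff_neumannCoeff n
  have hα := entireCoeff_neumannPolyCoeff n
  intro x hx
  have hx' : (x : ℂ) ≠ 0 := by exact_mod_cast hx.ne'
  have hL : HasDerivAt (fun x : ℝ => ((Real.log (x / 2) : ℝ) : ℂ)) (1 / x : ℂ) x := by
    have := ((hasDerivAt_id' x).div_const 2).log (by positivity)
    refine this.ofReal_comp.congr_deriv ?_
    push_cast
    field_simp
  obtain ⟨h1, h2⟩ := hB x hx
  constructor
  · refine ((hasDerivAt_frob hα (-n) z hx).add (((hasDerivAt_frob hσ n z hx).sub
      ((hL.const_mul 2).mul h1)).const_mul (z ^ n))).congr_deriv ?_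
    rw [neumannSolDeriv]
    ring
  · refine ((hasDerivAt_frob (hα.affine_mul _ 2) (-n) z hx).add
      ((((hasDerivAt_frob (hσ.affine_mul _ 2) n z hx).sub (h1.const_mul 2)).sub
      ((hL.const_mul 2).mul h2)).const_mul (z ^ n))).congr_deriv ?_
    have e1 := psum_neumannPolyCoeff_sq n (z * x ^ 2 / 4)
    have e2 := psum_neumannCoeff_sq n (z * x ^ 2 / 4)
    have e3 := pow_eq_mul_rpow n z (x := x)
    have e4 := rpow_neg_mul_cancel n hx
    simp only [neumannSol, frob]
    set ρ : ℂ := (((x / 2) ^ (n : ℝ) : ℝ) : ℂ)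
    set ρ' : ℂ := (((x / 2) ^ (-n : ℝ) : ℝ) : ℂ)
    set N : ℂ := n / n.factorial
    push_cast at e1 ⊢
    -- The two defects cancel because `ρ' tⁿ = zⁿ ρ` for `t = z x²/4`.
    linear_combination (ρ' / x) * e1 + (z ^ n * ρ / x) * e2 + (4 * N * ρ' / x) * e3
      + (4 * N * z ^ n * ρ / x) * e4

/-- The Wronskian of `frob n (besselCoeff n)` and `neumannSol n` as a function of `z x²/4`. -/
noncomputable def neumannWronskian (n : ℕ) (t : ℂ) : ℂ :=
  psum (besselCoeff n) t * psum (fun k => (((-n : ℝ) : ℂ) + 2 * k) * neumannPolyCoeff n k) t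
    - psum (fun k => (((n : ℝ) : ℂ) + 2 * k) * besselCoeff n k) t * psum (neumannPolyCoeff n) t
    + t ^ n * (psum (besselCoeff n) t *
        (psum (fun k => (((n : ℝ) : ℂ) + 2 * k) * neumannCoeff n k) t
          - 2 * psum (besselCoeff n) t)
      - psum (fun k => (((n : ℝ) : ℂ) + 2 * k) * besselCoeff n k) t * psum (neumannCoeff n) t)

theorem continuous_neumannWronskian (n : ℕ) : Continuous (neumannWronskian n) := by
  have ha := entireCoeff_of_recurrence (besselCoeff_recurrence (n.cast_nonneg (α := ℝ)))
  have h1 := continuous_psum ha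
  have h2 := continuous_psum (ha.affine_mul (n : ℝ) 2)
  have h3 := continuous_psum (entireCoeff_neumannCoeff n)
  have h4 := continuous_psum ((entireCoeff_neumannCoeff n).affine_mul (n : ℝ) 2)
  have h5 := continuous_psum (entireCoeff_neumannPolyCoeff n)
  have h6 := continuous_psum ((entireCoeff_neumannPolyCoeff n).affine_mul (-n : ℝ) 2)
  unfold neumannWronskian
  fun_prop

/-- The terms with `log (x/2)` cancel, and the powers of `x/2` combine into powers of `z x²/4`;
hence the limit at `0` exists. -/
theorem wronskian_neumannSol (n : ℕ) (z : ℂ) {x : ℝ} (hx : 0 < x) :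
    frob n (besselCoeff n) z x * neumannSolDeriv n z x
      - frob n (fun k => (((n : ℝ) : ℂ) + 2 * k) * besselCoeff n k) z x * neumannSol n z x
    = neumannWronskian n (z * x ^ 2 / 4) := by
  have e3 := pow_eq_mul_rpow n z (x := x)
  have e4 := rpow_neg_mul_cancel n hx
  simp only [neumannSol, neumannSolDeriv, frob, neumannWronskian, e3]
  set E := psum (besselCoeff n) (z * x ^ 2 / 4)
  set E' := psum (fun k => (((n : ℝ) : ℂ) + 2 * k) * besselCoeff n k) (z * x ^ 2 / 4)
  linear_combination (E * psum (fun k => (((-n : ℝ) : ℂ) + 2 * k) * neumannPolyCoeff n k)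
    (z * x ^ 2 / 4) - E' * psum (neumannPolyCoeff n) (z * x ^ 2 / 4)) * e4

/-! ### Uniform Wronskian bound, and the estimates with their weights. -/

/-- The second solution, its equation and the boundedness of its Wronskian with the first. -/
theorem exists_theta {ν : ℝ} (hν : 0 ≤ ν) : ∃ (q q₁ : ℂ → ℝ → ℂ) (C : ℝ),
    (∀ z (x : ℝ), 0 < x → theta (ν - 1 / 2) z x = (√x : ℂ) * q z x) ∧
    (∀ z, BesselSol ν z (q z) (q₁ z)) ∧
    ∀ z (x : ℝ), 0 < x → ‖frob ν (besselCoeff ν) z x * q₁ z x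
      - frob ν (fun k => (ν + 2 * k) * besselCoeff ν k) z x * q z x‖ ≤ C := by
  have hp := fun z => besselSol_frob (besselCoeff_recurrence hν) z (μ := ν) rfl
  have ha := entireCoeff_of_recurrence (besselCoeff_recurrence hν)
  by_cases h : ∃ n : ℕ, ν = n
  · obtain ⟨n, rfl⟩ := h
    set κ : ℂ := ((√(Real.pi / 2) / Real.pi : ℝ) : ℂ)
    have hw := fun z (x : ℝ) (hx : 0 < x) => (hp z).wronskian_eq (besselSol_neumannSol n z)
      (continuous_neumannWronskian n) (fun y hy => wronskian_neumannSol n z hy) hx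
    refine ⟨fun z x => κ * neumannSol n z x, fun z x => κ * neumannSolDeriv n z x, ‖κ * neumannWronskian n 0‖,
      fun z x hx => theta_eq_of_nat rfl z hx, fun z => (besselSol_neumannSol n z).const_mul κ,
      fun z x hx => ?_⟩
    rw [mul_left_comm, mul_left_comm _ κ, ← mul_sub, hw z x hx]
  · set κ : ℂ := ((√(Real.pi / 2) / Real.sin (ν * Real.pi) : ℝ) : ℂ)
    have hr : ∀ k : ℕ, ((k : ℂ) + 1) * (k + 1 + (-ν : ℝ)) * besselCoeff (-ν) (k + 1)
        = -besselCoeff (-ν) k := fun k => besselCoeff_succ k fun h0 =>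
      h ⟨k + 1, by push_cast; linarith⟩
    have hb := entireCoeff_of_recurrence hr
    have hq := fun z => besselSol_frob hr z (μ := ν) (by ring)
    have hw := fun z (x : ℝ) (hx : 0 < x) => (hp z).wronskian_eq (hq z)
      (w := fun t => psum (besselCoeff ν) t
          * psum (fun k : ℕ => ((-ν : ℝ) + 2 * k) * besselCoeff (-ν) k) t
        - psum (fun k : ℕ => (ν + 2 * k) * besselCoeff ν k) t * psum (besselCoeff (-ν)) t)
      (by
        have h1 := continuous_psum ha
        have h2 := continuous_psum (ha.affine_mul ν 2)
        have h3 := continuous_psum hb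
        have h4 := continuous_psum (hb.affine_mul (-ν : ℝ) 2)
        fun_prop)
      (fun y hy => by rw [frob_mul_frob_neg _ _ _ _ hy, frob_mul_frob_neg _ _ _ _ hy]) hx
    obtain ⟨c, hc⟩ : ∃ c, ∀ z (x : ℝ), 0 < x → frob ν (besselCoeff ν) z x
        * frob (-ν) (fun k => ((-ν : ℝ) + 2 * k) * besselCoeff (-ν) k) z x
        - frob ν (fun k => (ν + 2 * k) * besselCoeff ν k) z x
        * frob (-ν) (besselCoeff (-ν)) z x = c := ⟨_, hw⟩
    refine ⟨fun z x => κ * frob (-ν) (besselCoeff (-ν)) z x,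
      fun z x => κ * frob (-ν) (fun k => ((-ν : ℝ) + 2 * k) * besselCoeff (-ν) k) z x, ‖κ * c‖,
      fun z x hx => theta_eq_of_not_nat rfl hν h z hx, fun z => (hq z).const_mul κ,
      fun z x hx => ?_⟩
    rw [mul_left_comm, mul_left_comm _ κ, ← mul_sub, hc z x hx]

/-- Bounds on both sides are assumed because the exponent may have either sign, as `1/2 - ν` does.
-/
theorem rpow_le_two_rpow_mul {m n : ℝ} (hn : 0 < n) (h1 : n / 2 ≤ m) (h2 : m ≤ n) (e : ℝ) :
    n ^ e ≤ 2 ^ |e| * m ^ e := by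
  have hm : 0 < m := by linarith
  rcases le_total 0 e with he | he
  · rw [abs_of_nonneg he, ← Real.mul_rpow two_pos.le hm.le]
    exact Real.rpow_le_rpow hn.le (by linarith) he
  · calc n ^ e ≤ m ^ e := Real.rpow_le_rpow_of_nonpos hm h2 he
      _ ≤ _ := le_mul_of_one_le_left (by positivity)
        (Real.one_le_rpow one_le_two (abs_nonneg e))

theorem div_one_add_of_le {r x : ℝ} (hr : 0 ≤ r) (hx : 0 < x) (h : r * x ≤ 1) :
    x / 2 ≤ x / (1 + r * x) ∧ x / (1 + r * x) ≤ x := by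
  have : 0 ≤ r * x := by positivity
  exact ⟨div_le_div_of_nonneg_left hx.le (by linarith) (by linarith),
    div_le_self hx.le (by linarith)⟩

theorem div_one_add_of_ge {r x : ℝ} (hr : 0 < r) (h : 1 ≤ r * x) :
    1 / r / 2 ≤ x / (1 + r * x) ∧ x / (1 + r * x) ≤ 1 / r := by
  have h0 : 0 < 1 + r * x := by linarith
  constructor
  · rw [div_div, div_le_div_iff₀ (by positivity) h0]; linarith
  · rw [div_le_div_iff₀ h0 hr]; linarith

/-- The factor that is needed only for `ν = 0`. -/
noncomputable def logFactor (ν y : ℝ) : ℝ := if ν = 0 then 1 - Real.log y else 1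

theorem one_le_logFactor (ν : ℝ) {y : ℝ} (hy : 0 < y) (hy1 : y ≤ 1) : 1 ≤ logFactor ν y := by
  rw [logFactor]
  split_ifs
  · linarith [Real.log_nonpos hy.le hy1]
  · exact le_rfl

/-- Bounds in the region `‖z‖ x² ≤ 1` for solutions vanishing at `y`. -/
theorem exists_norm_le_of_le_one {ν : ℝ} (hν : 0 ≤ ν) : ∃ C : ℝ, 0 ≤ C ∧
    ∀ (z : ℂ) (g g₁ : ℝ → ℂ), BesselSol ν z g g₁ → ∀ x y : ℝ, 0 < y → y ≤ x → x ≤ 1 →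
      ‖z‖ * x ^ 2 ≤ 1 → g y = 0 →
      ‖g x‖ ≤ C * ((x / y) ^ ν * logFactor ν y) * ‖g₁ y‖ ∧
      ‖g₁ x‖ ≤ C * ((x / y) ^ ν * logFactor ν y) * ‖g₁ y‖ := by
  obtain ⟨K, hK, hΛ⟩ : ∃ K : ℝ, 0 ≤ K ∧ ∀ x y : ℝ, 0 < y → y ≤ x → x ≤ 1 →
      ∃ Λ : ℝ → ℝ, (∀ t, 0 < t → HasDerivAt Λ (t ^ (-2 * ν - 1)) t) ∧ Λ y = 0 ∧
        x ^ ν * y ^ ν * Λ x ≤ K * ((x / y) ^ ν * logFactor ν y) := by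
    rcases hν.eq_or_lt with h0 | h0
    · subst h0
      -- For `ν = 0` the primitive is `log (t / y)`, and `log x ≤ 0` leaves at most `-log y`.
      refine ⟨1, zero_le_one, fun x y hy hyx hx1 => ⟨fun t => Real.log t - Real.log y, ?_, ?_, ?_⟩⟩
      · intro t ht
        refine ((Real.hasDerivAt_log ht.ne').sub_const _).congr_deriv ?_
        simp [Real.rpow_neg_one]
      · simp
      · have := Real.log_nonpos (hy.trans_le hyx).le hx1
        simp [logFactor]
        linarith
    · refine ⟨1 / (2 * ν), by positivity, fun x y hy hyx hx1 =>
        ⟨fun t => (y ^ (-2 * ν) - t ^ (-2 * ν)) / (2 * ν), ?_, ?_, ?_⟩⟩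
      · intro t ht
        refine (((Real.hasDerivAt_rpow_const (p := -2 * ν) (Or.inl ht.ne')).const_sub
          (y ^ (-2 * ν))).div_const (2 * ν)).congr_deriv ?_
        field_simp
      · simp
      · have hx : 0 < x := hy.trans_le hyx
        have e : y ^ ν * y ^ (-2 * ν) = (y ^ ν)⁻¹ := by
          rw [← Real.rpow_add hy, ← Real.rpow_neg hy.le]; congr 1; ring
        rw [logFactor, if_neg h0.ne', mul_one, Real.div_rpow hx.le hy.le]
        calc _ ≤ x ^ ν * y ^ ν * (y ^ (-2 * ν) / (2 * ν)) := by
              have : 0 ≤ x ^ (-2 * ν) := by positivity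
              dsimp only
              gcongr
              linarith
          _ = x ^ ν * (y ^ ν * y ^ (-2 * ν)) / (2 * ν) := by ring
          _ = _ := by rw [e]; ring
  refine ⟨(2 * ν + 2) * K + 1, by positivity, fun z g g₁ h x y hy hyx hx1 hz h0 => ?_⟩
  obtain ⟨Λ, h1, h2, h3⟩ := hΛ x y hy hyx hx1
  obtain ⟨h4, h5⟩ := h.norm_le_of_le_one hν hy hyx hz h0 h1 h2
  have hB : 1 ≤ (x / y) ^ ν * logFactor ν y := one_le_mul_of_one_le_of_one_le
    (Real.one_le_rpow ((one_le_div hy).2 hyx) hν) (one_le_logFactor ν hy (hyx.trans hx1))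
  set B := (x / y) ^ ν * logFactor ν y
  have hKB : 0 ≤ K * B := by positivity
  constructor
  · refine h4.trans (mul_le_mul_of_nonneg_right ?_ (norm_nonneg _))
    nlinarith [mul_nonneg hν hKB]
  · refine h5.trans (mul_le_mul_of_nonneg_right ?_ (norm_nonneg _))
    have := mul_le_mul_of_nonneg_left h3 (by positivity : 0 ≤ 2 * ν + 2)
    linarith

theorem sqrt_mul_sqrt_mul_rpow (ν : ℝ) {x y : ℝ} (hx : 0 < x) (hy : 0 < y) :
    √x * √y * (x / y) ^ ν = x ^ (ν + 1 / 2) * y ^ (1 / 2 - ν) := by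
  rw [Real.sqrt_eq_rpow, Real.sqrt_eq_rpow, Real.div_rpow hx.le hy.le, Real.rpow_add hx,
    Real.rpow_sub hy]
  ring

/-- Bounds for solutions vanishing at `y`. -/
theorem exists_norm_le {ν : ℝ} (hν : 0 ≤ ν) : ∃ C : ℝ, 0 ≤ C ∧
    ∀ (s : ℂ) (g g₁ : ℝ → ℂ), BesselSol ν (s ^ 2) g g₁ → ∀ x y : ℝ, 0 < y → y ≤ x → x ≤ 1 →
      g y = 0 →
      √x * √y * ‖g x‖ ≤ C * ((x / (1 + ‖s‖ * x)) ^ (ν + 1 / 2) *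
        (y / (1 + ‖s‖ * y)) ^ (1 / 2 - ν)) * Real.exp (|s.im| * (x - y)) * logFactor ν y
        * ‖g₁ y‖ := by
  obtain ⟨C, hC, hsmall⟩ := exists_norm_le_of_le_one hν
  set κ := Real.exp |ν ^ 2 - 1 / 4|
  have hκ : 1 ≤ κ := Real.one_le_exp (abs_nonneg _)
  -- Serves all three cases: `C` when both points are small, `3 κ C` when `y` is small and `x`
  -- large, `κ` when both are large.
  set D := κ * (3 * C + 1)
  have hD : 0 ≤ D := by positivity
  have hCD : C ≤ D := by nlinarith
  set c := (2 : ℝ) ^ |ν + 1 / 2| * 2 ^ |1 / 2 - ν|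
  refine ⟨D * c, by positivity, fun s g g₁ h x y hy hyx hx1 h0 => ?_⟩
  have hx : 0 < x := hy.trans_le hyx
  have hlf := one_le_logFactor ν hy (hyx.trans hx1)
  have hs := norm_nonneg s
  have hmx : 0 < x / (1 + ‖s‖ * x) := by positivity
  have hmy : 0 < y / (1 + ‖s‖ * y) := by positivity
  -- Here `u` and `v` stand for `min x (1/‖s‖)` and `min y (1/‖s‖)`, within a factor `2` of the
  -- weights.
  suffices H : ∃ u v : ℝ, 0 < u ∧ 0 < v ∧
      (u / 2 ≤ x / (1 + ‖s‖ * x) ∧ x / (1 + ‖s‖ * x) ≤ u) ∧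
      (v / 2 ≤ y / (1 + ‖s‖ * y) ∧ y / (1 + ‖s‖ * y) ≤ v) ∧
      √x * √y * ‖g x‖ ≤ D * (u ^ (ν + 1 / 2) * v ^ (1 / 2 - ν)) * Real.exp (|s.im| * (x - y))
        * logFactor ν y * ‖g₁ y‖ by
    obtain ⟨u, v, hu, hv, hu', hv', H⟩ := H
    refine H.trans ?_
    have e1 := rpow_le_two_rpow_mul hu hu'.1 hu'.2 (ν + 1 / 2)
    have e2 := rpow_le_two_rpow_mul hv hv'.1 hv'.2 (1 / 2 - ν)
    have e3 : D * (u ^ (ν + 1 / 2) * v ^ (1 / 2 - ν)) ≤ D * c *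
        ((x / (1 + ‖s‖ * x)) ^ (ν + 1 / 2) * (y / (1 + ‖s‖ * y)) ^ (1 / 2 - ν)) := by
      calc _ ≤ D * (((2 : ℝ) ^ |ν + 1 / 2| * (x / (1 + ‖s‖ * x)) ^ (ν + 1 / 2)) *
            (2 ^ |1 / 2 - ν| * (y / (1 + ‖s‖ * y)) ^ (1 / 2 - ν))) := by gcongr
        _ = _ := by simp only [c]; ring
    gcongr
  have hE : ∀ {a b : ℝ}, a ≤ b → 1 ≤ Real.exp (|s.im| * (b - a)) := fun hab =>
    Real.one_le_exp (mul_nonneg (abs_nonneg _) (sub_nonneg.2 hab))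
  rcases le_total (‖s‖ * x) 1 with hsx | hsx
  · have hsy : ‖s‖ * y ≤ 1 := (mul_le_mul_of_nonneg_left hyx hs).trans hsx
    refine ⟨x, y, hx, hy, div_one_add_of_le hs hx hsx, div_one_add_of_le hs hy hsy, ?_⟩
    have hz : ‖s ^ 2‖ * x ^ 2 ≤ 1 := by
      rw [norm_pow, ← mul_pow]; exact pow_le_one₀ (by positivity) hsx
    have h1 := (hsmall _ g g₁ h x y hy hyx hx1 hz h0).1
    calc _ ≤ √x * √y * (C * ((x / y) ^ ν * logFactor ν y) * ‖g₁ y‖) := by gcongr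
      _ = C * (√x * √y * (x / y) ^ ν) * 1 * logFactor ν y * ‖g₁ y‖ := by ring
      _ ≤ _ := by
        rw [sqrt_mul_sqrt_mul_rpow ν hx hy]
        gcongr
        exact hE hyx
  have hs0 : 0 < ‖s‖ := by
    rcases hs.eq_or_lt with h0 | h0
    · rw [← h0] at hsx; norm_num at hsx
    · exact h0
  rcases le_total (‖s‖ * y) 1 with hsy | hsy
  -- The solution is followed from `y` to the transition point `a`, then from `a` to `x` by the
  -- energy bound with data at `a`.
  · set a := 1 / ‖s‖
    have ha : 0 < a := by positivity
    have hsa : ‖s‖ * a = 1 := mul_one_div_cancel hs0.ne'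
    have hya : y ≤ a := by rw [le_div_iff₀ hs0]; linarith
    have hax : a ≤ x := by rw [div_le_iff₀ hs0]; linarith
    refine ⟨a, y, ha, hy, div_one_add_of_ge hs0 hsx, div_one_add_of_le hs hy hsy, ?_⟩
    have hz : ‖s ^ 2‖ * a ^ 2 ≤ 1 := by rw [norm_pow, ← mul_pow, hsa, one_pow]
    obtain ⟨h1, h2⟩ := hsmall _ g g₁ h a y hy hya (hax.trans hx1) hz h0
    have h3 := h.norm_le_of_one_le ha hsa.ge hax
    rw [hsa, div_one] at h3
    calc √x * √y * ‖g x‖ = √y * (√x * ‖g x‖) := by ring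
      _ ≤ √y * (κ * (√a * (2 * (C * ((a / y) ^ ν * logFactor ν y) * ‖g₁ y‖) +
          C * ((a / y) ^ ν * logFactor ν y) * ‖g₁ y‖)) * Real.exp (|s.im| * (x - a))) := by
        refine mul_le_mul_of_nonneg_left (h3.trans ?_) (Real.sqrt_nonneg _)
        gcongr
      _ = (κ * (3 * C)) * (√a * √y * (a / y) ^ ν) * Real.exp (|s.im| * (x - a)) * logFactor ν y
          * ‖g₁ y‖ := by ring
      _ ≤ _ := by
        rw [sqrt_mul_sqrt_mul_rpow ν ha hy]
        gcongr
        simp only [D]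
        gcongr
        linarith
  · set a := 1 / ‖s‖
    have ha : 0 < a := by positivity
    -- With `u = v = 1/‖s‖` the two powers multiply to `1/‖s‖`, the gain from `g y = 0` in the
    -- energy bound.
    refine ⟨a, a, ha, ha, div_one_add_of_ge hs0 hsx, div_one_add_of_ge hs0 hsy, ?_⟩
    have h3 := h.norm_le_of_one_le hy hsy hyx
    rw [h0, norm_zero, mul_zero, zero_add] at h3
    have e : a ^ (ν + 1 / 2) * a ^ (1 / 2 - ν) = a := by
      rw [← Real.rpow_add ha]; ring_nf; simp
    rw [e]
    have e2 : √y * √y = y := Real.mul_self_sqrt hy.le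
    calc √x * √y * ‖g x‖ = √y * (√x * ‖g x‖) := by ring
      _ ≤ √y * (κ * (√y * (‖g₁ y‖ / (‖s‖ * y))) * Real.exp (|s.im| * (x - y))) :=
        mul_le_mul_of_nonneg_left h3 (Real.sqrt_nonneg _)
      _ = κ * a * Real.exp (|s.im| * (x - y)) * 1 * ‖g₁ y‖ := by
        simp only [a]
        field_simp
        rw [sq, e2, mul_comm]
      _ ≤ _ := by
        gcongr
        simp only [D]
        nlinarith

theorem exists_norm_frob_le {b : ℕ → ℂ} (hb : EntireCoeff b) {ν : ℝ} (hν : 0 ≤ ν) :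
    ∃ C : ℝ, 0 ≤ C ∧ ∀ (z : ℂ) (x : ℝ), 0 < x → ‖z‖ * x ^ 2 ≤ 1 → ‖frob ν b z x‖ ≤ C * x ^ ν := by
  refine ⟨∑' k, ‖b k‖, tsum_nonneg fun _ => norm_nonneg _, fun z x hx hz => ?_⟩
  have ht : ‖z * x ^ 2 / 4‖ ≤ 1 := by
    rw [norm_div, norm_mul, norm_pow, Complex.norm_real, Real.norm_eq_abs, sq_abs]
    norm_num
    linarith
  rw [frob, norm_mul, Complex.norm_real, Real.norm_eq_abs, abs_of_nonneg (by positivity), mul_comm]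
  have h1 := norm_psum_le hb ht
  have h2 : (x / 2) ^ ν ≤ x ^ ν := Real.rpow_le_rpow (by positivity) (by linarith) hν
  gcongr

/-- The power series bounds `p` and `x p'` up to `1/‖s‖`; beyond it the energy bound takes over. -/
theorem exists_norm_phi_le {ν : ℝ} (hν : 0 ≤ ν) : ∃ C : ℝ, 0 ≤ C ∧
    ∀ (z : ℂ) (x : ℝ), 0 < x → ‖phi (ν - 1 / 2) z x‖ ≤
      C * (x / (1 + √‖z‖ * x)) ^ (ν + 1 / 2) * Real.exp (|(csqrt z).im| * x) := by
  have ha := entireCoeff_of_recurrence (besselCoeff_recurrence hν)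
  obtain ⟨A, hA, hA'⟩ := exists_norm_frob_le ha hν
  obtain ⟨B, hB, hB'⟩ := exists_norm_frob_le (ha.affine_mul ν 2) hν
  set κ := Real.exp |ν ^ 2 - 1 / 4|
  have hκ : 1 ≤ κ := Real.one_le_exp (abs_nonneg _)
  set D := κ * (2 * A + B)
  have hD : 0 ≤ D := by positivity
  have hAD : A ≤ D := by nlinarith
  refine ⟨√(Real.pi / 2) * (D * 2 ^ |ν + 1 / 2|), by positivity, fun z x hx => ?_⟩
  rw [phi_eq rfl z hx, ← norm_csqrt]
  have hsz := csqrt_sq z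
  set s := csqrt z
  have hs := norm_nonneg s
  have hmx : 0 < x / (1 + ‖s‖ * x) := by positivity
  have hsol := besselSol_frob (besselCoeff_recurrence hν) z (μ := ν) rfl
  have hr : ∀ a : ℝ, 0 < a → √a * a ^ ν = a ^ (ν + 1 / 2) := fun a ha => by
    rw [Real.sqrt_eq_rpow, Real.rpow_add ha]; ring
  suffices H : ∃ u : ℝ, 0 < u ∧ (u / 2 ≤ x / (1 + ‖s‖ * x) ∧ x / (1 + ‖s‖ * x) ≤ u) ∧
      √x * ‖frob ν (besselCoeff ν) z x‖ ≤ D * u ^ (ν + 1 / 2) * Real.exp (|s.im| * x) by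
    obtain ⟨u, hu, hu', H⟩ := H
    have e1 := rpow_le_two_rpow_mul hu hu'.1 hu'.2 (ν + 1 / 2)
    rw [norm_mul, norm_mul, Complex.norm_real, Complex.norm_real, Real.norm_eq_abs,
      Real.norm_eq_abs, abs_of_nonneg (Real.sqrt_nonneg _), abs_of_nonneg (Real.sqrt_nonneg _)]
    calc _ = √(Real.pi / 2) * (√x * ‖frob ν (besselCoeff ν) z x‖) := by ring
      _ ≤ √(Real.pi / 2) * (D * (2 ^ |ν + 1 / 2| * (x / (1 + ‖s‖ * x)) ^ (ν + 1 / 2))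
          * Real.exp (|s.im| * x)) := by
        refine mul_le_mul_of_nonneg_left (H.trans ?_) (Real.sqrt_nonneg _)
        gcongr
      _ = _ := by ring
  rcases le_total (‖s‖ * x) 1 with hsx | hsx
  · refine ⟨x, hx, div_one_add_of_le hs hx hsx, ?_⟩
    have hz : ‖z‖ * x ^ 2 ≤ 1 := by
      rw [← hsz, norm_pow, ← mul_pow]; exact pow_le_one₀ (by positivity) hsx
    calc _ ≤ √x * (A * x ^ ν) := by gcongr; exact hA' z x hx hz
      _ = A * (√x * x ^ ν) * 1 := by ring
      _ ≤ _ := by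
        rw [hr x hx]
        gcongr
        exact Real.one_le_exp (by positivity)
  · have hs0 : 0 < ‖s‖ := by
      rcases hs.eq_or_lt with h0 | h0
      · rw [← h0] at hsx; norm_num at hsx
      · exact h0
    set a := 1 / ‖s‖
    have ha : 0 < a := by positivity
    have hsa : ‖s‖ * a = 1 := mul_one_div_cancel hs0.ne'
    have hax : a ≤ x := by rw [div_le_iff₀ hs0]; linarith
    refine ⟨a, ha, div_one_add_of_ge hs0 hsx, ?_⟩
    have hz : ‖z‖ * a ^ 2 ≤ 1 := by rw [← hsz, norm_pow, ← mul_pow, hsa, one_pow]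
    have hsol' := hsol
    rw [← hsz] at hsol'
    have h3 := hsol'.norm_le_of_one_le ha hsa.ge hax
    rw [hsa, div_one, hsz] at h3
    have h1 := hA' z a ha hz
    have h2 := hB' z a ha hz
    calc _ ≤ κ * (√a * (2 * (A * a ^ ν) + B * a ^ ν)) * Real.exp (|s.im| * x) := by
          refine h3.trans ?_
          gcongr
          linarith
      _ = D * (√a * a ^ ν) * Real.exp (|s.im| * x) := by simp only [D]; ring
      _ ≤ _ := by rw [hr a ha]

theorem exists_norm_green_le {ν : ℝ} (hν : 0 ≤ ν) : ∃ C : ℝ, 0 ≤ C ∧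
    ∀ (z : ℂ) (x y : ℝ), 0 < y → y ≤ x → x < 1 → ‖green (ν - 1 / 2) z x y‖ ≤
      C * ((x / (1 + √‖z‖ * x)) ^ (ν + 1 / 2) * (y / (1 + √‖z‖ * y)) ^ (1 / 2 - ν)) *
        Real.exp (|(csqrt z).im| * (x - y)) * logFactor ν y := by
  obtain ⟨q, q₁, W, hq, hsol, hW⟩ := exists_theta hν
  obtain ⟨C, hC, hb⟩ := exists_norm_le hν
  have hW0 : 0 ≤ W := (norm_nonneg _).trans (hW 0 1 one_pos)
  refine ⟨√(Real.pi / 2) * (C * W), by positivity, fun z x y hy hyx hx1 => ?_⟩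
  have hx : 0 < x := hy.trans_le hyx
  set p := frob ν (besselCoeff ν) z
  set p₁ := frob ν (fun k => (ν + 2 * k) * besselCoeff ν k) z
  have hp : BesselSol ν z p p₁ := besselSol_frob (besselCoeff_recurrence hν) z rfl
  -- The kernel `K`, which vanishes at `y`; in `h2` its `x d/dx` there is recognised as minus the
  -- Wronskian.
  have hK := (hp.const_mul (q z y)).sub ((hsol z).const_mul (p y))
  rw [← csqrt_sq z] at hK
  have h1 := hb _ _ _ hK x y hy hyx hx1.le (by rw [csqrt_sq]; ring)
  have h2 : ‖q (csqrt z ^ 2) y * p₁ y - p y * q₁ (csqrt z ^ 2) y‖ ≤ W := by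
    rw [csqrt_sq, ← norm_neg]
    refine le_of_eq_of_le (congrArg _ ?_) (hW z y hy)
    simp only [p, p₁]
    ring
  have hlf := (zero_le_one.trans (one_le_logFactor ν hy (hyx.trans hx1.le)))
  have e : green (ν - 1 / 2) z x y = ((√(Real.pi / 2) * (√x * √y) : ℝ) : ℂ) *
      (q z y * p x - p y * q z x) := by
    rw [green, phi_eq rfl z hx, phi_eq rfl z hy, hq z x hx, hq z y hy]
    push_cast
    ring
  rw [e, norm_mul, Complex.norm_real, Real.norm_eq_abs, abs_of_nonneg (by positivity), mul_assoc]
  rw [csqrt_sq] at h1 h2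
  rw [norm_csqrt] at h1
  calc _ ≤ √(Real.pi / 2) * (C * ((x / (1 + √‖z‖ * x)) ^ (ν + 1 / 2) *
        (y / (1 + √‖z‖ * y)) ^ (1 / 2 - ν)) * Real.exp (|(csqrt z).im| * (x - y))
        * logFactor ν y * W) := by
        refine mul_le_mul_of_nonneg_left (h1.trans ?_) (Real.sqrt_nonneg _)
        gcongr
    _ = _ := by ring

end SphericalSchrodinger

theorem mainTheorem6 :
    (∀ l : ℝ, -1 / 2 < l → ∃ C : ℝ,
      (∀ (z : ℂ) (x : ℝ), 0 < x → x < 1 →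
        ‖SphericalSchrodinger.phi l z x‖ ≤
          C * (x / (1 + Real.sqrt ‖z‖ * x)) ^ (l + 1)
            * Real.exp (|(SphericalSchrodinger.csqrt z).im| * x)) ∧
      (∀ (z : ℂ) (x y : ℝ), 0 < y → y ≤ x → x < 1 →
        ‖SphericalSchrodinger.green l z x y‖ ≤
          C * (x / (1 + Real.sqrt ‖z‖ * x)) ^ (l + 1)
            * ((1 + Real.sqrt ‖z‖ * y) / y) ^ l
            * Real.exp (|(SphericalSchrodinger.csqrt z).im| * (x - y)))) ∧
    (∃ C : ℝ,
      (∀ (z : ℂ) (x : ℝ), 0 < x → x < 1 →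
        ‖SphericalSchrodinger.phi (-1 / 2) z x‖ ≤
          C * (x / (1 + Real.sqrt ‖z‖ * x)) ^ ((-1 / 2 : ℝ) + 1)
            * Real.exp (|(SphericalSchrodinger.csqrt z).im| * x)) ∧
      (∀ (z : ℂ) (x y : ℝ), 0 < y → y ≤ x → x < 1 →
        ‖SphericalSchrodinger.green (-1 / 2) z x y‖ ≤
          C * (x * y / ((1 + Real.sqrt ‖z‖ * x) * (1 + Real.sqrt ‖z‖ * y))) ^ (1 / 2 : ℝ)
            * Real.exp (|(SphericalSchrodinger.csqrt z).im| * (x - y))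
            * (1 - Real.log y))) := by
  constructor
  · intro l hl
    have hν : 0 < l + 1 / 2 := by linarith
    obtain ⟨A, hA, hA'⟩ := SphericalSchrodinger.exists_norm_phi_le hν.le
    obtain ⟨B, hB, hB'⟩ := SphericalSchrodinger.exists_norm_green_le hν.le
    have e1 : l + 1 / 2 + 1 / 2 = l + 1 := by ring
    have e2 : 1 / 2 - (l + 1 / 2) = -l := by ring
    rw [add_sub_cancel_right, e1] at hA' hB'
    refine ⟨max A B, fun z x hx _ => (hA' z x hx).trans ?_, fun z x y hy hyx hx1 =>
      (hB' z x y hy hyx hx1).trans ?_⟩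
    · gcongr
      exact le_max_left _ _
    · have hx : 0 < x := hy.trans_le hyx
      have e3 : (y / (1 + √‖z‖ * y)) ^ (-l) = ((1 + √‖z‖ * y) / y) ^ l := by
        rw [Real.rpow_neg (by positivity), ← Real.inv_rpow (by positivity), inv_div]
      rw [SphericalSchrodinger.logFactor, if_neg hν.ne', mul_one, e2, e3, ← mul_assoc]
      gcongr
      exact le_max_right _ _
  · obtain ⟨A, hA, hA'⟩ := SphericalSchrodinger.exists_norm_phi_le le_rfl
    obtain ⟨B, hB, hB'⟩ := SphericalSchrodinger.exists_norm_green_le le_rfl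
    have e1 : (0 : ℝ) - 1 / 2 = -1 / 2 := by ring
    have e2 : (-1 / 2 : ℝ) + 1 = 0 + 1 / 2 := by ring
    rw [e1] at hA' hB'
    refine ⟨max A B, fun z x hx _ => (hA' z x hx).trans ?_, fun z x y hy hyx hx1 =>
      (hB' z x y hy hyx hx1).trans ?_⟩
    · rw [e2]
      gcongr
      exact le_max_left _ _
    · have hx : 0 < x := hy.trans_le hyx
      have hl := Real.log_nonpos hy.le (hyx.trans hx1.le)
      have hl' : 0 ≤ 1 - Real.log y := by linarith
      rw [SphericalSchrodinger.logFactor, if_pos rfl, zero_add, sub_zero,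
        ← Real.mul_rpow (by positivity) (by positivity), div_mul_div_comm]
      gcongr
      exact le_max_right _ _
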